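/- Let $d \ge 0$ be an integer, let $K$ be a constant real symmetric positive semidefinite $d \times d$ matrix, let $J$ be any real $d \times d$ matrix, and let $\Sigma$ be a real symmetric positive definite $d \times d$ matrix. For a symmetric positive definite matrix $S$ write $$g_S(x) = \frac{1}{\sqrt{(2\pi)^d \det S}}\, \exp\!\Big(-\tfrac12\, x^{T} S^{-1} x\Big), \qquad x \in \mathbb{R}^d,$$ for the density of the Gaussian distribution $N(0,S)$. Consider the Fokker–Planck equation with linear drift $$\frac{\partial u}{\partial t} = \tfrac12\, \nabla\cdot\big(K \nabla u\big) - \nabla\cdot\big((Jx)\,u\big). \qquad (*)$$ For $0 < T \le \infty$, a solution of $(*)$ on $[0,T)$ means a function $u$ that is continuous on $\mathbb{R}^d \times [0,T)$, whose derivatives $\partial_t u$, $\nabla_x u$, $\nabla_x^2 u$ exist and are continuous on $\mathbb{R}^d \times (0,T)$, that satisfies $(*)$ there, and for which $u(\cdot,t)$ is a probability density on $\mathbb{R}^d$ for every $t \in [0,T)$. Then the Gaussian form of the initial density $u(\cdot,0) = g_\Sigma$ is preserved: there are symmetric positive definite matrices $S(t)$, $t \ge 0$, depending only on $J$, $K$,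 $\Sigma$, with $S(0) = \Sigma$, such that 1. $u(x,t) = g_{S(t)}(x)$ is a solution of $(*)$ on $[0,\infty)$; and 2. for every $0 < T \le \infty$, every solution $u$ of $(*)$ on $[0,T)$ with $u(\cdot,0) = g_\Sigma$ satisfies $u(\cdot,t) = g_{S(t)}$ for all $t \in (0,T)$. -/

import Mathlib

namespace FokkerPlanck

/-- The divergence of a vector field on Euclidean space: the sum of the partial derivatives of its
`i`-th component in the `i`-th coordinate direction. -/
noncomputable def divergence {d : ℕ}
    (F : EuclideanSpace ℝ (Fin d) → EuclideanSpace ℝ (Fin d))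
    (x : EuclideanSpace ℝ (Fin d)) : ℝ :=
  ∑ i : Fin d, (fderiv ℝ F x (EuclideanSpace.single i 1)) i

/-- The right-hand side `½ ∇·(K ∇w) - ∇·((J x) w)` of the Fokker-Planck equation with constant
process noise matrix `K` and linear drift `x ↦ J x`, applied to a function `w` of space. -/
noncomputable def generator {d : ℕ} (J K : Matrix (Fin d) (Fin d) ℝ)
    (w : EuclideanSpace ℝ (Fin d) → ℝ) (x : EuclideanSpace ℝ (Fin d)) : ℝ :=
  1 / 2 * divergence (fun y => Matrix.toEuclideanLin K (gradient w y)) x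
    - divergence (fun y => w y • Matrix.toEuclideanLin J y) x

/-- `w` is a probability density function on Euclidean space (with respect to Lebesgue measure). -/
structure IsPDF {d : ℕ} (w : EuclideanSpace ℝ (Fin d) → ℝ) : Prop where
  nonneg : ∀ x, 0 ≤ w x
  integrable : MeasureTheory.Integrable w
  integral_eq_one : ∫ x, w x = 1

/-- `u` (written `u t x`, time first) is a classical solution on the time interval `[0, T)`, where
`T = ⊤` is allowed, of the Fokker-Planck equation with noise matrix `K` and drift `x ↦ J x`, and
`u t` is a probability density at every time: `u` is continuous up to time `0`, and on `(0, T)` the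
time derivative and the space derivatives of order at most two exist, are jointly continuous and
satisfy the equation. Nothing is required of `u` outside `[0, T)`. -/
structure IsSolution {d : ℕ} (J K : Matrix (Fin d) (Fin d) ℝ) (T : EReal)
    (u : ℝ → EuclideanSpace ℝ (Fin d) → ℝ) : Prop where
  isPDF : ∀ t : ℝ, 0 ≤ t → (t : EReal) < T → IsPDF (u t)
  continuousOn : ContinuousOn (fun p : ℝ × EuclideanSpace ℝ (Fin d) => u p.1 p.2)
    {p | 0 ≤ p.1 ∧ (p.1 : EReal) < T}
  contDiff_space : ∀ t : ℝ, 0 < t → (t : EReal) < T → ContDiff ℝ 2 (u t)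
  continuousOn_deriv_time :
    ContinuousOn (fun p : ℝ × EuclideanSpace ℝ (Fin d) => deriv (fun s => u s p.2) p.1)
      {p | 0 < p.1 ∧ (p.1 : EReal) < T}
  continuousOn_fderiv_space :
    ContinuousOn (fun p : ℝ × EuclideanSpace ℝ (Fin d) => fderiv ℝ (u p.1) p.2)
      {p | 0 < p.1 ∧ (p.1 : EReal) < T}
  continuousOn_fderiv_fderiv_space :
    ContinuousOn (fun p : ℝ × EuclideanSpace ℝ (Fin d) => fderiv ℝ (fderiv ℝ (u p.1)) p.2)
      {p | 0 < p.1 ∧ (p.1 : EReal) < T}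
  equation : ∀ t : ℝ, 0 < t → (t : EReal) < T → ∀ x : EuclideanSpace ℝ (Fin d),
    HasDerivAt (fun s => u s x) (generator J K (u t) x) t

/-- The density of the centred Gaussian distribution with covariance matrix `S`. -/
noncomputable def gaussianDensity {d : ℕ} (S : Matrix (Fin d) (Fin d) ℝ)
    (x : EuclideanSpace ℝ (Fin d)) : ℝ :=
  1 / Real.sqrt ((2 * Real.pi) ^ d * S.det)
    * Real.exp (-(x.ofLp ⬝ᵥ (S⁻¹).mulVec x.ofLp) / 2)

end FokkerPlanck

/-! ### Matrix exponential and the Lyapunov equation -/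

namespace FokkerPlanck
open Matrix

section MatrixExp

attribute [local instance] Matrix.linftyOpNormedRing Matrix.linftyOpNormedAlgebra

/-! Existence is an ansatz. Both `generator J K` and the time derivative turn `gaussianDensity (S
t)` into itself times a quadratic polynomial in x, and the two polynomials agree as soon as S' = JS
+ SJᵀ + K (`hasDerivAt_gaussianDensity`). Variation of constants solves this linear equation
explicitly (`lyapunovFlow`), and the formula shows that S(t) stays positive definite for t ≥ 0.

Uniqueness is by duality, since nothing is known about the decay of u or its derivatives beyond
u(·,t) being a probability density. The backward adjoint equation has the bounded solutions ψ =
exp(q(s)) cos(ξ(s)·x + θ) with ξ' = -Jᵀξ and q' = ½ ξ·Kξ, whose frequency at the final time is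
arbitrary. Formally ∫ uψ is constant in time. To prove it, ψ is multiplied by a cutoff χ at radius
r. The remaining error involves only derivatives of χ; even the drift term Jx·∇χ is bounded
uniformly in r, because |x| is of order r where ∇χ is of order 1/r. So the error is at most a
constant times the mass of u outside a large ball. This mass is at most 1 and tends to 0 at each
time, so dominated convergence removes the error (`IsSolution.integral_planeWave_eq`). The initial
density thus determines the characteristic function at every later time, hence the continuous
density itself (`IsPDF.eq_of_integral_cos_eq`). -/

theorem hasDerivAt_matrix_exp_smul_apply {d : ℕ} (J : Matrix (Fin d) (Fin d) ℝ) (t : ℝ)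
    (i j : Fin d) :
    HasDerivAt (fun s : ℝ => NormedSpace.exp (s • J) i j) ((J * NormedSpace.exp (t • J)) i j) t :=
  (LinearMap.toContinuousLinearMap (Matrix.entryLinearMap ℝ ℝ i j)).hasFDerivAt.comp_hasDerivAt t
    (hasDerivAt_exp_smul_const' J t)

end MatrixExp

/-- Derivatives of matrix curves are taken entrywise here and below, so no norm on matrices has to
be fixed. -/
theorem hasDerivAt_matrix_mul_apply {d : ℕ} {A B : ℝ → Matrix (Fin d) (Fin d) ℝ}
    {A' B' : Matrix (Fin d) (Fin d) ℝ} {t : ℝ}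
    (hA : ∀ i j, HasDerivAt (fun s => A s i j) (A' i j) t)
    (hB : ∀ i j, HasDerivAt (fun s => B s i j) (B' i j) t) (i j : Fin d) :
    HasDerivAt (fun s => (A s * B s) i j) ((A' * B t + A t * B') i j) t := by
  simp only [Matrix.mul_apply, Matrix.add_apply, ← Finset.sum_add_distrib]
  exact HasDerivAt.fun_sum fun k _ => (hA i k).mul (hB k j)

theorem continuous_matrix_exp_smul {d : ℕ} (J : Matrix (Fin d) (Fin d) ℝ) :
    Continuous fun s : ℝ => NormedSpace.exp (s • J) :=
  continuous_matrix fun i j => continuous_iff_continuousAt.2 fun t =>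
    (hasDerivAt_matrix_exp_smul_apply J t i j).continuousAt

/-- The Lyapunov flow with drift `J`, forcing `K` and initial value `S₀`. -/
noncomputable def lyapunovFlow {d : ℕ} (J K S₀ : Matrix (Fin d) (Fin d) ℝ) (t : ℝ) :
    Matrix (Fin d) (Fin d) ℝ :=
  NormedSpace.exp (t • J) *
    (S₀ + Matrix.of fun i j => ∫ s in (0 : ℝ)..t,
      (NormedSpace.exp ((-s) • J) * K * (NormedSpace.exp ((-s) • J))ᵀ) i j) *
    (NormedSpace.exp (t • J))ᵀ

variable {d : ℕ} (J K S₀ : Matrix (Fin d) (Fin d) ℝ)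

theorem lyapunovFlow_zero : lyapunovFlow J K S₀ 0 = S₀ := by
  ext i j
  simp [lyapunovFlow]

theorem continuous_lyapunov_integrand : Continuous fun s : ℝ =>
    NormedSpace.exp ((-s) • J) * K * (NormedSpace.exp ((-s) • J))ᵀ := by
  have h : Continuous fun s : ℝ => NormedSpace.exp ((-s) • J) :=
    (continuous_matrix_exp_smul J).comp continuous_neg
  exact (h.mul continuous_const).mul h.matrix_transpose

/-- Variation of constants: the outer exponentials produce JS and SJᵀ, and conjugating the integrand
at time t by exp(tJ) gives back K. -/
theorem hasDerivAt_lyapunovFlow (t : ℝ) (i j : Fin d) :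
    HasDerivAt (fun s => lyapunovFlow J K S₀ s i j)
      ((J * lyapunovFlow J K S₀ t + lyapunovFlow J K S₀ t * Jᵀ + K) i j) t := by
  have hE := hasDerivAt_matrix_exp_smul_apply J t
  have hET : ∀ i j, HasDerivAt (fun s : ℝ => (NormedSpace.exp (s • J))ᵀ i j)
      (((NormedSpace.exp (t • J))ᵀ * Jᵀ) i j) t := fun i j => by
    rw [← Matrix.transpose_mul]
    exact hE j i
  set F : ℝ → Matrix (Fin d) (Fin d) ℝ := fun s =>
    NormedSpace.exp ((-s) • J) * K * (NormedSpace.exp ((-s) • J))ᵀ with hF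
  have hFc : Continuous F := continuous_lyapunov_integrand J K
  have hM : ∀ i j, HasDerivAt
      (fun s : ℝ => (S₀ + Matrix.of fun i j => ∫ r in (0 : ℝ)..s, F r i j) i j) (F t i j) t := by
    intro i j
    have hc : Continuous fun s => F s i j := hFc.matrix_elem i j
    simpa using (hc.integral_hasStrictDerivAt 0 t).hasDerivAt
  have hinv : NormedSpace.exp (t • J) * NormedSpace.exp ((-t) • J) = 1 := by
    rw [neg_smul]
    have := (Matrix.exp_add_of_commute (t • J) (-(t • J)) (Commute.refl _).neg_right)
    rw [← this]; simp
  have hinvT : (NormedSpace.exp ((-t) • J))ᵀ * (NormedSpace.exp (t • J))ᵀ = 1 := by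
    rw [← Matrix.transpose_mul, hinv, Matrix.transpose_one]
  refine (hasDerivAt_matrix_mul_apply (hasDerivAt_matrix_mul_apply hE hM) hET i j).congr_deriv ?_
  have h3 : NormedSpace.exp (t • J) * F t * (NormedSpace.exp (t • J))ᵀ = K := by
    calc _ = (NormedSpace.exp (t • J) * NormedSpace.exp ((-t) • J)) * K *
          ((NormedSpace.exp ((-t) • J))ᵀ * (NormedSpace.exp (t • J))ᵀ) := by
            simp only [hF, Matrix.mul_assoc]
      _ = K := by rw [hinv, hinvT, Matrix.one_mul, Matrix.mul_one]
  have h4 : ∀ A B C D : Matrix (Fin d) (Fin d) ℝ,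
      (A * B + C) * D = A * B * D + C * D := fun A B C D => add_mul _ _ _
  rw [h4, h3]
  simp only [lyapunovFlow, Matrix.mul_assoc, hF, Matrix.add_apply]
  ring

/-- For t ≥ 0 the integral of positive semidefinite matrices is positive semidefinite; adding it to
S₀ and applying the congruence by the invertible exp(tJ) preserves definiteness. -/
theorem lyapunovFlow_posDef (hK : K.PosSemidef) (hS₀ : S₀.PosDef) {t : ℝ} (ht : 0 ≤ t) :
    (lyapunovFlow J K S₀ t).PosDef := by
  set F : ℝ → Matrix (Fin d) (Fin d) ℝ := fun s =>
    NormedSpace.exp ((-s) • J) * K * (NormedSpace.exp ((-s) • J))ᵀ with hF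
  have hFc : Continuous F := continuous_lyapunov_integrand J K
  have hFp : ∀ s, (F s).PosSemidef := fun s => by
    simpa only [Matrix.conjTranspose_eq_transpose_of_trivial] using
      hK.mul_mul_conjTranspose_same (NormedSpace.exp ((-s) • J))
  have hI : (Matrix.of fun i j => ∫ s in (0 : ℝ)..t, F s i j).PosSemidef := by
    refine Matrix.PosSemidef.of_dotProduct_mulVec_nonneg ?_ fun x => ?_
    · ext i j
      simp only [Matrix.conjTranspose_apply, Matrix.of_apply, star_trivial]
      congr 1
      ext s
      simpa using (hFp s).1.apply i j
    · have : star x ⬝ᵥ ((Matrix.of fun i j => ∫ s in (0 : ℝ)..t, F s i j) *ᵥ x) =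
          ∫ s in (0 : ℝ)..t, star x ⬝ᵥ (F s *ᵥ x) := by
        simp only [dotProduct, mulVec, Matrix.of_apply]
        rw [intervalIntegral.integral_finsetSum]
        · refine Finset.sum_congr rfl fun i _ => ?_
          rw [intervalIntegral.integral_const_mul, intervalIntegral.integral_finsetSum]
          · congr 1
            exact Finset.sum_congr rfl fun j _ => (intervalIntegral.integral_mul_const _ _).symm
          · exact fun j _ => ((hFc.matrix_elem i j).mul_const _).intervalIntegrable _ _
        · intro i _
          exact (continuous_const.mul (continuous_finsetSum _ fun j _ =>
            (hFc.matrix_elem i j).mul_const _)).intervalIntegrable _ _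
      rw [this]
      exact intervalIntegral.integral_nonneg ht fun s _ => (hFp s).dotProduct_mulVec_nonneg x
  have := (hS₀.add_posSemidef hI).mul_mul_conjTranspose_same (B := NormedSpace.exp (t • J))
    (Matrix.vecMul_injective_of_isUnit (Matrix.isUnit_exp _))
  simpa only [Matrix.conjTranspose_eq_transpose_of_trivial, lyapunovFlow] using this

end FokkerPlanck

/-! ### Derivatives of determinants and inverses -/

namespace FokkerPlanck
open Matrix

theorem hasDerivAt_det_sum {d : ℕ} {A : ℝ → Matrix (Fin d) (Fin d) ℝ}
    {A' : Matrix (Fin d) (Fin d) ℝ} {t : ℝ}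
    (hA : ∀ i j, HasDerivAt (fun s => A s i j) (A' i j) t) :
    HasDerivAt (fun s => (A s).det)
      (∑ σ : Equiv.Perm (Fin d), ((Equiv.Perm.sign σ : ℤ) : ℝ) *
        ∑ i, (∏ j ∈ Finset.univ.erase i, A t (σ j) j) • A' (σ i) i) t := by
  simp only [Matrix.det_apply']
  exact HasDerivAt.fun_sum fun σ _ =>
    (HasDerivAt.fun_finsetProd fun i _ => hA (σ i) i).const_mul _

/-- **Jacobi's formula** for the derivative of a determinant at an invertible matrix. -/
theorem hasDerivAt_det {d : ℕ} {A : ℝ → Matrix (Fin d) (Fin d) ℝ}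
    {A' : Matrix (Fin d) (Fin d) ℝ} {t : ℝ}
    (hA : ∀ i j, HasDerivAt (fun s => A s i j) (A' i j) t) (h : IsUnit (A t).det) :
    HasDerivAt (fun s => (A s).det) ((A t).det * ((A t)⁻¹ * A').trace) t := by
  -- By `hasDerivAt_det_sum` the derivative depends only on A t and A', so the curve may be replaced
  -- by its tangent line, where the trace can be read off.
  have hline : HasDerivAt (fun s => (A t + (s - t) • A').det)
      ((A t).det * ((A t)⁻¹ * A').trace) t := by
    have heq : (fun s : ℝ => (A t + (s - t) • A').det) =
        fun s => (A t).det * (1 + (s - t) • ((A t)⁻¹ * A')).det := by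
      funext s
      rw [← Matrix.det_mul, Matrix.mul_add, Matrix.mul_one, Matrix.mul_smul, ← Matrix.mul_assoc,
        Matrix.mul_nonsing_inv _ h, Matrix.one_mul]
    rw [heq]
    refine HasDerivAt.const_mul _ ?_
    -- The remainder polynomial in det(1 + rM) = 1 + r tr M + r² p(r).
    set p := (det (1 + (Polynomial.X : Polynomial ℝ) •
      ((A t)⁻¹ * A').map Polynomial.C)).divX.divX
    have h1 : HasDerivAt (fun r : ℝ => 1 + ((A t)⁻¹ * A').trace * r + p.eval r * r ^ 2)
        ((A t)⁻¹ * A').trace (t - t) := by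
      rw [sub_self]
      have h2 := (((hasDerivAt_id (0 : ℝ)).const_mul ((A t)⁻¹ * A').trace).const_add 1).add
        ((p.hasDerivAt 0).mul (hasDerivAt_pow 2 (0 : ℝ)))
      refine h2.congr_deriv ?_
      simp
    refine (h1.comp_sub_const t t).congr_of_eventuallyEq (Filter.Eventually.of_forall fun s => ?_)
    exact Matrix.det_one_add_smul (s - t) ((A t)⁻¹ * A')
  have hline' := hasDerivAt_det_sum (A := fun s => A t + (s - t) • A') (A' := A') (t := t)
    fun i j => by
      simpa using ((((hasDerivAt_id t).sub_const t).mul_const (A' i j)).const_add (A t i j))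
  have := hasDerivAt_det_sum hA
  rw [hline.unique hline']
  simpa using this

theorem differentiableAt_inv_apply {d : ℕ} {A : ℝ → Matrix (Fin d) (Fin d) ℝ}
    {A' : Matrix (Fin d) (Fin d) ℝ} {t : ℝ}
    (hA : ∀ i j, HasDerivAt (fun s => A s i j) (A' i j) t) (h : IsUnit (A t).det) (i j : Fin d) :
    DifferentiableAt ℝ (fun s => (A s)⁻¹ i j) t := by
  simp only [Matrix.inv_def, Matrix.smul_apply, Ring.inverse_eq_inv', smul_eq_mul,
    Matrix.adjugate_apply]
  refine ((hasDerivAt_det_sum hA).differentiableAt.inv h.ne_zero).mul ?_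
  -- An adjugate entry is the determinant of A with row j made constant, so that row contributes
  -- derivative 0.
  refine (hasDerivAt_det_sum (A' := A'.updateRow j 0) fun k l => ?_).differentiableAt
  by_cases hk : k = j
  · subst hk
    simpa using hasDerivAt_const t _
  · simpa [Matrix.updateRow_ne hk] using hA k l

/-- Once differentiability is known, the value comes from differentiating A⁻¹A = 1, valid near t
because the determinant stays nonzero. -/
theorem hasDerivAt_inv_apply {d : ℕ} {A : ℝ → Matrix (Fin d) (Fin d) ℝ}
    {A' : Matrix (Fin d) (Fin d) ℝ} {t : ℝ}
    (hA : ∀ i j, HasDerivAt (fun s => A s i j) (A' i j) t) (h : IsUnit (A t).det) (i j : Fin d) :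
    HasDerivAt (fun s => (A s)⁻¹ i j) ((-((A t)⁻¹ * A' * (A t)⁻¹)) i j) t := by
  have hB : ∀ i j, HasDerivAt (fun s => (A s)⁻¹ i j)
      ((Matrix.of fun i j => deriv (fun s => (A s)⁻¹ i j) t) i j) t :=
    fun i j => (differentiableAt_inv_apply hA h i j).hasDerivAt
  set B' : Matrix (Fin d) (Fin d) ℝ := Matrix.of fun i j => deriv (fun s => (A s)⁻¹ i j) t
  have hev : ∀ᶠ s in nhds t, (A s)⁻¹ * A s = 1 := by
    filter_upwards [(hasDerivAt_det_sum hA).continuousAt.eventually_ne h.ne_zero] with s hs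
    exact Matrix.nonsing_inv_mul _ hs.isUnit
  have hzero : B' * A t + (A t)⁻¹ * A' = 0 := by
    ext k l
    refine (hasDerivAt_matrix_mul_apply hB hA k l).unique ?_
    refine (hasDerivAt_const t ((1 : Matrix (Fin d) (Fin d) ℝ) k l)).congr_of_eventuallyEq ?_
    filter_upwards [hev] with s hs
    rw [hs]
  have : B' = -((A t)⁻¹ * A' * (A t)⁻¹) := by
    have := congrArg (· * (A t)⁻¹) (eq_neg_of_add_eq_zero_left hzero)
    simpa [Matrix.mul_assoc, Matrix.mul_nonsing_inv _ h] using this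
  rw [← this]
  exact hB i j

theorem hasDerivAt_dotProduct_mulVec {d : ℕ} {A : ℝ → Matrix (Fin d) (Fin d) ℝ}
    {A' : Matrix (Fin d) (Fin d) ℝ} {t : ℝ}
    (hA : ∀ i j, HasDerivAt (fun s => A s i j) (A' i j) t) (x : Fin d → ℝ) :
    HasDerivAt (fun s => x ⬝ᵥ A s *ᵥ x) (x ⬝ᵥ A' *ᵥ x) t := by
  simp only [dotProduct, mulVec]
  exact HasDerivAt.fun_sum fun i _ =>
    (HasDerivAt.fun_sum fun j _ => (hA i j).mul_const (x j)).const_mul (x i)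

end FokkerPlanck

/-! ### Divergence calculus and space derivatives of Gaussians -/

namespace FokkerPlanck
open Matrix

section Divergence

variable {d : ℕ}

local notation "𝔼" => EuclideanSpace ℝ (Fin d)

theorem _root_.HasFDerivAt.divergence_eq {F : 𝔼 → 𝔼} {F' : 𝔼 →L[ℝ] 𝔼} {x : 𝔼}
    (h : HasFDerivAt F F' x) : divergence F x = ∑ i, F' (EuclideanSpace.single i 1) i := by
  rw [divergence, h.fderiv]

theorem divergence_smul {f : 𝔼 → ℝ} {F : 𝔼 → 𝔼} {x : 𝔼} (hf : DifferentiableAt ℝ f x)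
    (hF : DifferentiableAt ℝ F x) :
    divergence (fun y => f y • F y) x = inner ℝ (gradient f x) (F x) + f x * divergence F x := by
  rw [HasFDerivAt.divergence_eq (hf.hasFDerivAt.fun_smul hF.hasFDerivAt), inner_gradient_left, divergence,
    Finset.mul_sum, add_comm]
  simp only [_root_.add_apply, _root_.smul_apply,
    ContinuousLinearMap.smulRight_apply, PiLp.add_apply, PiLp.smul_apply, smul_eq_mul,
    Finset.sum_add_distrib]
  congr 1
  conv_rhs => rw [← (EuclideanSpace.basisFun (Fin d) ℝ).sum_repr (F x)]
  simp [mul_comm]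

theorem divergence_add {F G : 𝔼 → 𝔼} {x : 𝔼} (hF : DifferentiableAt ℝ F x)
    (hG : DifferentiableAt ℝ G x) :
    divergence (fun y => F y + G y) x = divergence F x + divergence G x := by
  rw [HasFDerivAt.divergence_eq (hF.hasFDerivAt.fun_add hG.hasFDerivAt), divergence, divergence,
    ← Finset.sum_add_distrib]
  rfl

theorem divergence_toEuclideanLin (M : Matrix (Fin d) (Fin d) ℝ) (x : 𝔼) :
    divergence (fun y => toEuclideanLin M y) x = M.trace := by
  have := (toEuclideanLin M).toContinuousLinearMap.hasFDerivAt (x := x)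
  refine (HasFDerivAt.divergence_eq (F := fun y => toEuclideanLin M y) this).trans ?_
  simp [Matrix.trace]

theorem differentiable_toEuclideanLin (M : Matrix (Fin d) (Fin d) ℝ) :
    Differentiable ℝ fun y : 𝔼 => toEuclideanLin M y :=
  (toEuclideanLin M).toContinuousLinearMap.differentiable

theorem contDiff_toEuclideanLin (M : Matrix (Fin d) (Fin d) ℝ) {n : WithTop ℕ∞} :
    ContDiff ℝ n fun y : 𝔼 => toEuclideanLin M y :=
  (toEuclideanLin M).toContinuousLinearMap.contDiff

theorem inner_toEuclideanLin_left (M : Matrix (Fin d) (Fin d) ℝ) (x y : 𝔼) :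
    inner ℝ (toEuclideanLin M x) y = inner ℝ x (toEuclideanLin Mᵀ y) := by
  simp only [EuclideanSpace.inner_eq_star_dotProduct, star_trivial, Matrix.ofLp_toLpLin,
    Matrix.toLin'_apply]
  rw [Matrix.dotProduct_mulVec, Matrix.mulVec_transpose]

end Divergence

section Gaussian

variable {d : ℕ}

local notation "𝔼" => EuclideanSpace ℝ (Fin d)

theorem dotProduct_mulVec_eq_inner (M : Matrix (Fin d) (Fin d) ℝ) (x : 𝔼) :
    x.ofLp ⬝ᵥ M *ᵥ x.ofLp = inner ℝ (toEuclideanLin M x) x := by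
  simp [EuclideanSpace.inner_eq_star_dotProduct]

theorem contDiff_gaussianDensity (S : Matrix (Fin d) (Fin d) ℝ) {n : WithTop ℕ∞} :
    ContDiff ℝ n (gaussianDensity S) := by
  unfold gaussianDensity
  simp only [dotProduct_mulVec_eq_inner]
  exact contDiff_const.mul ((((contDiff_toEuclideanLin _).inner ℝ contDiff_id).neg.div_const 2).exp)

theorem fderiv_gaussianDensity {S : Matrix (Fin d) (Fin d) ℝ} (hS : S.PosDef) (x v : 𝔼) :
    fderiv ℝ (gaussianDensity S) x v =
      -(gaussianDensity S x * inner ℝ (toEuclideanLin S⁻¹ x) v) := by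
  have hL := (toEuclideanLin S⁻¹).toContinuousLinearMap.hasFDerivAt (x := x)
  have hq := (hL.inner ℝ (hasFDerivAt_id x))
  have hg := ((hq.neg.mul_const (1 / 2)).exp).const_mul (1 / Real.sqrt ((2 * Real.pi) ^ d * S.det))
  have hsymm : (S⁻¹)ᵀ = S⁻¹ := by simpa using hS.inv.isHermitian.eq
  have heq : gaussianDensity S = fun y => 1 / Real.sqrt ((2 * Real.pi) ^ d * S.det) *
      Real.exp (-inner ℝ (toEuclideanLin S⁻¹ y) y * (1 / 2)) := by
    funext y
    rw [gaussianDensity, dotProduct_mulVec_eq_inner]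
    simp [div_eq_mul_inv]
  rw [heq]
  have h2 : inner ℝ (toEuclideanLin S⁻¹ v) x = inner ℝ (toEuclideanLin S⁻¹ x) v := by
    rw [inner_toEuclideanLin_left, hsymm, real_inner_comm]
  refine (congrArg (· v) (HasFDerivAt.fderiv hg)).trans ?_
  simp only [fderivInnerCLM_apply, ContinuousLinearMap.comp_apply, ContinuousLinearMap.prod_apply,
    LinearMap.coe_toContinuousLinearMap', ContinuousLinearMap.id_apply, id_eq, h2, Pi.neg_apply,
    _root_.neg_apply, _root_.smul_apply, smul_eq_mul]
  ring

theorem gradient_gaussianDensity {S : Matrix (Fin d) (Fin d) ℝ} (hS : S.PosDef) (x : 𝔼) :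
    gradient (gaussianDensity S) x = -(gaussianDensity S x • toEuclideanLin S⁻¹ x) := by
  refine ext_inner_right ℝ fun v => ?_
  rw [inner_gradient_left, fderiv_gaussianDensity hS, inner_neg_left, real_inner_smul_left]

theorem fderiv_fderiv_gaussianDensity {S : Matrix (Fin d) (Fin d) ℝ} (hS : S.PosDef) (x v w : 𝔼) :
    fderiv ℝ (fderiv ℝ (gaussianDensity S)) x v w =
      gaussianDensity S x * (inner ℝ (toEuclideanLin S⁻¹ x) v * inner ℝ (toEuclideanLin S⁻¹ x) w
        - inner ℝ (toEuclideanLin S⁻¹ v) w) := by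
  have h1 : fderiv ℝ (fderiv ℝ (gaussianDensity S)) x v w =
      fderiv ℝ (fun y => fderiv ℝ (gaussianDensity S) y w) x v := by
    rw [fderiv_clm_apply ((contDiff_gaussianDensity S (n := 2)).fderiv_right (m := 1) (by norm_num)
      |>.differentiable (by norm_num) x) (differentiableAt_const w)]
    simp
  rw [h1]
  simp only [fderiv_gaussianDensity hS]
  have hg := ((contDiff_gaussianDensity S (n := 1)).differentiable (by norm_num) x).hasFDerivAt
  have hL := ((toEuclideanLin S⁻¹).toContinuousLinearMap.hasFDerivAt (x := x)).inner ℝ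
    (hasFDerivAt_const w x)
  have := (hg.mul hL).neg
  refine (congrArg (· v) (HasFDerivAt.fderiv this)).trans ?_
  simp [fderivInnerCLM_apply, fderiv_gaussianDensity hS]
  ring

/-- The gradient of the Gaussian g is -g S⁻¹x, so the diffusive and drift fluxes are both g times a
linear field, whose divergence is a trace. -/
theorem generator_gaussianDensity (J K : Matrix (Fin d) (Fin d) ℝ)
    {S : Matrix (Fin d) (Fin d) ℝ} (hS : S.PosDef) (x : 𝔼) :
    generator J K (gaussianDensity S) x = gaussianDensity S x *
      (1 / 2 * (inner ℝ (toEuclideanLin S⁻¹ x) (toEuclideanLin (K * S⁻¹) x) - (K * S⁻¹).trace) +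
        inner ℝ (toEuclideanLin S⁻¹ x) (toEuclideanLin J x) - J.trace) := by
  have hd := (contDiff_gaussianDensity S (n := 1)).differentiable (by norm_num) x
  have h1 : (fun y => toEuclideanLin K (gradient (gaussianDensity S) y)) =
      fun y => gaussianDensity S y • toEuclideanLin (-(K * S⁻¹)) y := by
    funext y
    rw [gradient_gaussianDensity hS, map_neg, map_smul]
    simp
  rw [generator, h1, divergence_smul hd (differentiable_toEuclideanLin _ x),
    divergence_smul hd (differentiable_toEuclideanLin _ x), gradient_gaussianDensity hS,
    divergence_toEuclideanLin, divergence_toEuclideanLin]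
  simp only [map_neg, LinearMap.neg_apply, inner_neg_left, inner_neg_right, real_inner_smul_left,
    Matrix.trace_neg]
  ring

end Gaussian
end FokkerPlanck

/-! ### Normalization of Gaussians and existence -/

namespace FokkerPlanck
open Matrix

section Gaussian

variable {d : ℕ}

local notation "𝔼" => EuclideanSpace ℝ (Fin d)

/-- Factoring S⁻¹ = BᵀB, the substitution y = Bx reduces to the standard Gaussian integral, with
Jacobian |det B|⁻¹ = √(det S). -/
theorem integral_gaussianDensity {S : Matrix (Fin d) (Fin d) ℝ} (hS : S.PosDef) :
    ∫ x, gaussianDensity S x = 1 := by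
  obtain ⟨B, hB⟩ : ∃ B : Matrix (Fin d) (Fin d) ℝ, S⁻¹ = Bᵀ * B := by
    open scoped MatrixOrder in
    obtain ⟨B, hB⟩ := CStarAlgebra.nonneg_iff_eq_star_mul_self.1 hS.inv.posSemidef.nonneg
    exact ⟨B, by simpa [Matrix.star_eq_conjTranspose] using hB⟩
  have hdet : S.det⁻¹ = B.det ^ 2 := by
    have := congrArg Matrix.det hB
    rw [Matrix.det_nonsing_inv, Ring.inverse_eq_inv', Matrix.det_mul, Matrix.det_transpose] at this
    rw [this, sq]
  have hdpos := hS.det_pos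
  have hBne : B.det ≠ 0 := fun h => by
    rw [h] at hdet
    simp [hdpos.ne'] at hdet
  have hlin : LinearMap.det (toEuclideanLin B) = B.det := by
    exact LinearMap.det_toLin (PiLp.basisFun 2 ℝ (Fin d)) B
  have hmap := MeasureTheory.Measure.map_linearMap_addHaar_eq_smul_addHaar
    (MeasureTheory.volume : MeasureTheory.Measure 𝔼) (f := toEuclideanLin B) (by rwa [hlin])
  have hint : ∫ x : 𝔼, Real.exp (-(1 / 2) * ‖toEuclideanLin B x‖ ^ 2) =
      |B.det|⁻¹ * (2 * Real.pi) ^ ((d : ℝ) / 2) := by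
    have h1 := MeasureTheory.integral_map (μ := (MeasureTheory.volume : MeasureTheory.Measure 𝔼))
      (φ := toEuclideanLin B) (differentiable_toEuclideanLin B).continuous.aemeasurable
      (f := fun y : 𝔼 => Real.exp (-(1 / 2) * ‖y‖ ^ 2))
      (by fun_prop)
    rw [← h1, hmap, MeasureTheory.integral_smul_measure,
      GaussianFourier.integral_rexp_neg_mul_sq_norm (by norm_num), hlin,
      ENNReal.toReal_ofReal (abs_nonneg _), abs_inv]
    simp [mul_comm]
  have hq : ∀ x : 𝔼, gaussianDensity S x = 1 / Real.sqrt ((2 * Real.pi) ^ d * S.det) *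
      Real.exp (-(1 / 2) * ‖toEuclideanLin B x‖ ^ 2) := fun x => by
    rw [gaussianDensity, dotProduct_mulVec_eq_inner, hB, ← real_inner_self_eq_norm_sq]
    conv_rhs => rw [inner_toEuclideanLin_left, real_inner_comm]
    simp only [Matrix.toLpLin_apply, Matrix.mulVec_mulVec]
    congr 2
    ring
  simp only [hq]
  rw [MeasureTheory.integral_const_mul, hint]
  have hs : |B.det|⁻¹ = Real.sqrt S.det := by
    rw [← Real.sqrt_sq_eq_abs, ← hdet, ← Real.sqrt_inv, inv_inv]
  have hp : (2 * Real.pi) ^ ((d : ℝ) / 2) = Real.sqrt ((2 * Real.pi) ^ d) := by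
    rw [Real.sqrt_eq_rpow, ← Real.rpow_natCast, ← Real.rpow_mul (by positivity)]
    congr 1; ring
  rw [hs, hp, Real.sqrt_mul (by positivity)]
  have h1 : Real.sqrt S.det ≠ 0 := (Real.sqrt_pos.2 hdpos).ne'
  have h2 : Real.sqrt ((2 * Real.pi) ^ d) ≠ 0 := (Real.sqrt_pos.2 (by positivity)).ne'
  field_simp

theorem isPDF_gaussianDensity {S : Matrix (Fin d) (Fin d) ℝ} (hS : S.PosDef) :
    IsPDF (gaussianDensity S) where
  nonneg x := by unfold gaussianDensity; positivity
  -- The integral of a non-integrable function is 0 by convention, so the value 1 already gives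
  -- integrability.
  integrable := MeasureTheory.Integrable.of_integral_ne_zero (by
    rw [integral_gaussianDensity hS]; exact one_ne_zero)
  integral_eq_one := integral_gaussianDensity hS

/-- The normalizing factor contributes -½ tr(S⁻¹S') and the exponent ½ xᵀS⁻¹S'S⁻¹x; the Lyapunov
equation makes their sum the polynomial of `generator_gaussianDensity`. -/
theorem hasDerivAt_gaussianDensity (J K : Matrix (Fin d) (Fin d) ℝ)
    {S : ℝ → Matrix (Fin d) (Fin d) ℝ} {t : ℝ} (hS : (S t).PosDef)
    (hS' : ∀ i j, HasDerivAt (fun s => S s i j) ((J * S t + S t * Jᵀ + K) i j) t) (x : 𝔼) :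
    HasDerivAt (fun s => gaussianDensity (S s) x) (generator J K (gaussianDensity (S t)) x) t := by
  have hdpos := hS.det_pos
  have hu : IsUnit (S t).det := hdpos.ne'.isUnit
  have hdet := hasDerivAt_det hS' hu
  have hquad := hasDerivAt_dotProduct_mulVec (hasDerivAt_inv_apply hS' hu) x.ofLp
  have hpos : 0 < (2 * Real.pi) ^ d * (S t).det := by positivity
  have hsq := (hdet.const_mul ((2 * Real.pi) ^ d)).sqrt hpos.ne'
  have h := (hsq.inv (Real.sqrt_pos.2 hpos).ne').mul ((hquad.neg.div_const 2).exp)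
  have hPS : (S t)⁻¹ * S t = 1 := Matrix.nonsing_inv_mul _ hu
  have hSP : S t * (S t)⁻¹ = 1 := Matrix.mul_nonsing_inv _ hu
  have hsymm : ((S t)⁻¹)ᵀ = (S t)⁻¹ := by simpa using hS.inv.isHermitian.eq
  have htr : ((S t)⁻¹ * (J * S t + S t * Jᵀ + K)).trace =
      2 * J.trace + (K * (S t)⁻¹).trace := by
    rw [Matrix.mul_add, Matrix.mul_add, ← Matrix.mul_assoc _ (S t), hPS, Matrix.trace_add,
      Matrix.trace_add, Matrix.trace_mul_comm, Matrix.mul_assoc J, hSP, Matrix.one_mul,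
      Matrix.mul_one, Matrix.trace_transpose, Matrix.trace_mul_comm _ K]
    ring
  have hxx : x.ofLp ⬝ᵥ -((S t)⁻¹ * (J * S t + S t * Jᵀ + K) * (S t)⁻¹) *ᵥ x.ofLp =
      -(2 * inner ℝ (toEuclideanLin (S t)⁻¹ x) (toEuclideanLin J x) +
        inner ℝ (toEuclideanLin (S t)⁻¹ x) (toEuclideanLin (K * (S t)⁻¹) x)) := by
    have e : (S t)⁻¹ * (J * S t + S t * Jᵀ + K) * (S t)⁻¹ =
        (S t)⁻¹ * J + Jᵀ * (S t)⁻¹ + (S t)⁻¹ * (K * (S t)⁻¹) := by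
      simp only [Matrix.mul_add, Matrix.add_mul, ← Matrix.mul_assoc, hPS, Matrix.one_mul]
      simp only [Matrix.mul_assoc, hSP, Matrix.mul_one]
    have a1 : ∀ M : Matrix (Fin d) (Fin d) ℝ, x.ofLp ⬝ᵥ ((S t)⁻¹ * M) *ᵥ x.ofLp =
        inner ℝ (toEuclideanLin (S t)⁻¹ x) (toEuclideanLin M x) := fun M => by
      rw [inner_toEuclideanLin_left, hsymm, dotProduct_mulVec_eq_inner, real_inner_comm]
      simp [Matrix.toLpLin_apply, Matrix.mulVec_mulVec]
    have a2 : x.ofLp ⬝ᵥ (Jᵀ * (S t)⁻¹) *ᵥ x.ofLp =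
        inner ℝ (toEuclideanLin (S t)⁻¹ x) (toEuclideanLin J x) := by
      rw [real_inner_comm, inner_toEuclideanLin_left, dotProduct_mulVec_eq_inner, real_inner_comm]
      simp [Matrix.toLpLin_apply, Matrix.mulVec_mulVec]
    rw [e, Matrix.neg_mulVec, dotProduct_neg, Matrix.add_mulVec, Matrix.add_mulVec,
      dotProduct_add, dotProduct_add, a1, a1, a2]
    ring
  have hfun : (fun s => gaussianDensity (S s) x) = fun s =>
      (Real.sqrt ((2 * Real.pi) ^ d * (S s).det))⁻¹ *
        Real.exp (-(x.ofLp ⬝ᵥ (S s)⁻¹ *ᵥ x.ofLp) / 2) := by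
    funext s
    rw [gaussianDensity, one_div]
  rw [hfun]
  refine h.congr_deriv ?_
  rw [generator_gaussianDensity J K hS, gaussianDensity, htr, hxx]
  have hs0 := (Real.sqrt_pos.2 hpos).ne'
  simp only [Pi.neg_apply, Pi.inv_apply]
  have hss : Real.sqrt ((2 * Real.pi) ^ d * (S t).det) ^ 2 = (2 * Real.pi) ^ d * (S t).det :=
    Real.sq_sqrt hpos.le
  rw [← mul_assoc ((2 * Real.pi) ^ d)]
  set r := Real.sqrt ((2 * Real.pi) ^ d * (S t).det)
  rw [← hss]
  field_simp
  ring

theorem continuous_toEuclideanLin_apply {X : Type*} [TopologicalSpace X]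
    {A : X → Matrix (Fin d) (Fin d) ℝ} {x : X → 𝔼}
    (hA : Continuous A) (hx : Continuous x) :
    Continuous fun p => toEuclideanLin (A p) (x p) := by
  simp only [Matrix.toLpLin_apply]
  have h1 : Continuous fun p => A p *ᵥ (x p).ofLp :=
    hA.matrix_mulVec ((PiLp.continuous_ofLp 2 (fun _ : Fin d => ℝ)).comp hx)
  exact (PiLp.continuous_toLp 2 (fun _ : Fin d => ℝ)).comp h1

theorem continuous_inv_of_posDef {X : Type*} [TopologicalSpace X]
    {A : X → Matrix (Fin d) (Fin d) ℝ}
    (hA : Continuous A) (h : ∀ p, (A p).PosDef) :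
    Continuous fun p => (A p)⁻¹ := by
  simp only [Matrix.inv_def, Ring.inverse_eq_inv']
  exact (hA.matrix_det.inv₀ fun p => (h p).det_pos.ne').smul hA.matrix_adjugate

theorem continuous_gaussianDensity {X : Type*} [TopologicalSpace X]
    {A : X → Matrix (Fin d) (Fin d) ℝ} {x : X → 𝔼}
    (hA : Continuous A) (h : ∀ p, (A p).PosDef)
    (hx : Continuous x) : Continuous fun p => gaussianDensity (A p) (x p) := by
  unfold gaussianDensity
  simp only [dotProduct_mulVec_eq_inner]
  refine Continuous.mul (continuous_const.div (continuous_const.mul hA.matrix_det).sqrt fun p => ?_)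
    ((((continuous_toEuclideanLin_apply (continuous_inv_of_posDef hA h) hx).inner
      hx).neg.div_const 2).rexp)
  have := (h p).det_pos
  exact (Real.sqrt_pos.2 (by positivity)).ne'

/-- A Gaussian density whose covariance matrix solves the Lyapunov equation solves the
Fokker-Planck equation. -/
theorem isSolution_gaussianDensity {J K : Matrix (Fin d) (Fin d) ℝ}
    {S : ℝ → Matrix (Fin d) (Fin d) ℝ} (hS : ∀ t, 0 ≤ t → (S t).PosDef)
    (hS' : ∀ t i j, HasDerivAt (fun s => S s i j) ((J * S t + S t * Jᵀ + K) i j) t) :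
    IsSolution J K ⊤ fun t => gaussianDensity (S t) := by
  have hSc : Continuous S := continuous_matrix fun i j =>
    continuous_iff_continuousAt.2 fun t => (hS' t i j).continuousAt
  have heq : ∀ t : ℝ, 0 < t → (t : EReal) < ⊤ → ∀ x : 𝔼,
      HasDerivAt (fun s => gaussianDensity (S s) x) (generator J K (gaussianDensity (S t)) x) t :=
    fun t ht _ x => hasDerivAt_gaussianDensity J K (hS t ht.le) (hS' t) x
  -- Continuity is checked on the subtype, because S is assumed positive definite only at
  -- nonnegative times.
  let Ω : Set (ℝ × 𝔼) := {p | 0 < p.1 ∧ (p.1 : EReal) < ⊤}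
  have hΩ : ∀ p : Ω, (S p.1.1).PosDef := fun p => hS _ p.2.1.le
  have ht : Continuous fun p : Ω => S p.1.1 :=
    hSc.comp (continuous_fst.comp continuous_subtype_val)
  have hx : Continuous fun p : Ω => p.1.2 := continuous_snd.comp continuous_subtype_val
  have hP := continuous_inv_of_posDef ht hΩ
  have hg := continuous_gaussianDensity ht hΩ hx
  have hPx := continuous_toEuclideanLin_apply hP hx
  refine ⟨fun t ht _ => isPDF_gaussianDensity (hS t ht), ?_,
    fun t _ _ => contDiff_gaussianDensity _, ?_, ?_, ?_, heq⟩
  · rw [continuousOn_iff_continuous_domRestrict]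
    exact continuous_gaussianDensity (hSc.comp (continuous_fst.comp continuous_subtype_val))
      (fun p => hS _ p.2.1) (continuous_snd.comp continuous_subtype_val)
  · rw [continuousOn_iff_continuous_domRestrict]
    have : ∀ p : Ω, deriv (fun s => gaussianDensity (S s) p.1.2) p.1.1 = _ := fun p =>
      ((heq p.1.1 p.2.1 p.2.2 p.1.2).deriv).trans (generator_gaussianDensity J K (hΩ p) p.1.2)
    refine Continuous.congr ?_ fun p => (this p).symm
    refine hg.mul (((continuous_const.mul ((hPx.inner (continuous_toEuclideanLin_apply
      (continuous_const.mul hP) hx)).sub (continuous_const.mul hP).matrix_trace)).add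
      (hPx.inner (continuous_toEuclideanLin_apply continuous_const hx))).sub continuous_const)
  · rw [continuousOn_clm_apply]
    intro v
    rw [continuousOn_iff_continuous_domRestrict]
    refine Continuous.congr ?_ fun p : Ω => (fderiv_gaussianDensity (hΩ p) p.1.2 v).symm
    exact (hg.mul (hPx.inner continuous_const)).neg
  · rw [continuousOn_clm_apply]
    intro v
    rw [continuousOn_clm_apply]
    intro w
    rw [continuousOn_iff_continuous_domRestrict]
    refine Continuous.congr ?_ fun p : Ω => (fderiv_fderiv_gaussianDensity (hΩ p) p.1.2 v w).symm
    exact hg.mul (((hPx.inner continuous_const).mul (hPx.inner continuous_const)).sub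
      ((continuous_toEuclideanLin_apply hP continuous_const).inner continuous_const))

end Gaussian
end FokkerPlanck

/-! ### Integration by parts and differentiation under the integral -/

namespace FokkerPlanck
open Matrix MeasureTheory Set

section Weak

variable {d : ℕ}

local notation "𝔼" => EuclideanSpace ℝ (Fin d)

theorem contDiff_gradient {w : 𝔼 → ℝ} (hw : ContDiff ℝ 2 w) : ContDiff ℝ 1 (gradient w) :=
  (InnerProductSpace.toDual ℝ 𝔼).symm.contDiff.comp (hw.fderiv_right (m := 1) (by norm_num))

theorem continuous_gradient {w : 𝔼 → ℝ} (hw : ContDiff ℝ 1 w) : Continuous (gradient w) :=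
  (InnerProductSpace.toDual ℝ 𝔼).symm.continuous.comp (hw.continuous_fderiv (by norm_num))

theorem contDiff_toEuclideanLin_gradient (K : Matrix (Fin d) (Fin d) ℝ) {w : 𝔼 → ℝ}
    (hw : ContDiff ℝ 2 w) : ContDiff ℝ 1 fun y => toEuclideanLin K (gradient w y) :=
  (contDiff_toEuclideanLin K).comp (contDiff_gradient hw)

theorem continuous_divergence {F : 𝔼 → 𝔼} (hF : ContDiff ℝ 1 F) : Continuous (divergence F) := by
  have := hF.continuous_fderiv (by norm_num)
  unfold divergence
  fun_prop

theorem _root_.HasCompactSupport.gradient {w : 𝔼 → ℝ} (hw : HasCompactSupport w) :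
    HasCompactSupport (gradient w) :=
  (hw.fderiv ℝ).comp_left (g := (InnerProductSpace.toDual ℝ 𝔼).symm) (map_zero _)

theorem _root_.HasCompactSupport.toEuclideanLin_gradient (K : Matrix (Fin d) (Fin d) ℝ)
    {w : 𝔼 → ℝ} (hw : HasCompactSupport w) :
    HasCompactSupport fun y => toEuclideanLin K (gradient w y) :=
  hw.gradient.comp_left (g := toEuclideanLin K) (map_zero _)

theorem _root_.HasCompactSupport.divergence {F : 𝔼 → 𝔼} (hF : HasCompactSupport F) :
    HasCompactSupport (divergence F) :=
  (hF.fderiv ℝ).comp_left (g := fun L : 𝔼 →L[ℝ] 𝔼 => ∑ i, L (EuclideanSpace.single i 1) i)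
    (by simp)

/-- Integration by parts for the divergence. -/
theorem integral_divergence_mul {F : 𝔼 → 𝔼} {φ : 𝔼 → ℝ} (hF : ContDiff ℝ 1 F)
    (hφ : ContDiff ℝ 1 φ) (hc : HasCompactSupport φ ∨ HasCompactSupport F) :
    ∫ x, divergence F x * φ x = -∫ x, inner ℝ (F x) (gradient φ x) := by
  have hFd := hF.differentiable (by norm_num)
  have hF' := hF.continuous_fderiv (by norm_num)
  have hφ' := hφ.continuous_fderiv (by norm_num)
  have hFc := hF.continuous
  have hφc := hφ.continuous
  have hi : ∀ i, HasCompactSupport φ ∨ HasCompactSupport fun x => F x i := fun i =>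
    hc.imp_right fun h => h.comp_left (g := fun v : 𝔼 => v i) rfl
  have hfi : ∀ i, ContDiff ℝ 1 fun x => F x i := fun i => by
    exact (EuclideanSpace.proj (𝕜 := ℝ) i).contDiff.comp hF
  have hfd : ∀ i x v, fderiv ℝ (fun x => F x i) x v = (fderiv ℝ F x v) i := fun i x v => by
    have := ((EuclideanSpace.proj (𝕜 := ℝ) i).hasFDerivAt (x := F x)).comp x (hFd x).hasFDerivAt
    exact congrArg (· v) (HasFDerivAt.fderiv this)
  have i1 : ∀ i, Integrable fun x => fderiv ℝ (fun x => F x i) x (EuclideanSpace.single i 1) * φ x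
      := fun i => by
    refine Continuous.integrable_of_hasCompactSupport ?_ ?_
    · simp only [hfd]; fun_prop
    · rcases hi i with h | h
      · exact h.mul_left
      · exact (h.fderiv_apply (𝕜 := ℝ) _).mul_right
  have i2 : ∀ i, Integrable fun x => F x i * fderiv ℝ φ x (EuclideanSpace.single i 1)
      := fun i => by
    refine Continuous.integrable_of_hasCompactSupport (by fun_prop) ?_
    · rcases hi i with h | h
      · exact (h.fderiv_apply (𝕜 := ℝ) _).mul_left
      · exact h.mul_right
  have i3 : ∀ i, Integrable fun x => F x i * φ x := fun i => by
    refine Continuous.integrable_of_hasCompactSupport (by fun_prop) ?_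
    · rcases hi i with h | h
      · exact h.mul_left
      · exact h.mul_right
  have e1 : ∀ x, divergence F x * φ x =
      ∑ i, fderiv ℝ (fun x => F x i) x (EuclideanSpace.single i 1) * φ x := fun x => by
    simp only [divergence, hfd, Finset.sum_mul]
  have e2 : ∀ x, inner ℝ (F x) (gradient φ x) =
      ∑ i, F x i * fderiv ℝ φ x (EuclideanSpace.single i 1) := fun x => by
    rw [real_inner_comm, inner_gradient_left]
    conv_lhs => rw [← (EuclideanSpace.basisFun (Fin d) ℝ).sum_repr (F x)]
    simp
  simp only [e1, e2]
  rw [integral_finsetSum _ fun i _ => i1 i, integral_finsetSum _ fun i _ => i2 i,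
    ← Finset.sum_neg_distrib]
  refine Finset.sum_congr rfl fun i _ => ?_
  rw [integral_mul_fderiv_eq_neg_fderiv_mul_of_integrable (i1 i) (i2 i) (i3 i)
    (fun x _ => (hfi i).differentiable (by norm_num) x)
    (fun x _ => hφ.differentiable (by norm_num) x), neg_neg]

/-- The formal adjoint of `generator`. -/
noncomputable def adjointGenerator (J K : Matrix (Fin d) (Fin d) ℝ) (φ : 𝔼 → ℝ) (x : 𝔼) : ℝ :=
  1 / 2 * divergence (fun y => toEuclideanLin K (gradient φ y)) x
    + inner ℝ (toEuclideanLin J x) (gradient φ x)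

/-- The diffusion term is integrated by parts twice, with symmetry of K exchanging the two gradients
in between, and the drift term once. Compact support of φ removes any need for decay of w. -/
theorem integral_generator_mul {J K : Matrix (Fin d) (Fin d) ℝ} (hK : Kᵀ = K) {w φ : 𝔼 → ℝ}
    (hw : ContDiff ℝ 2 w) (hφ : ContDiff ℝ 2 φ) (hc : HasCompactSupport φ) :
    ∫ x, generator J K w x * φ x = ∫ x, w x * adjointGenerator J K φ x := by
  have hw1 : ContDiff ℝ 1 w := hw.of_le (by norm_num)
  have hφ1 : ContDiff ℝ 1 φ := hφ.of_le (by norm_num)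
  have hJ : ContDiff ℝ 1 fun y : 𝔼 => w y • toEuclideanLin J y := hw1.smul (contDiff_toEuclideanLin J)
  have hKw := contDiff_toEuclideanLin_gradient K hw
  have hKφ := contDiff_toEuclideanLin_gradient K hφ
  have a1 := integral_divergence_mul hKw hφ1 (Or.inl hc)
  have a2 := integral_divergence_mul hKφ hw1 (Or.inr (hc.toEuclideanLin_gradient K))
  have a3 := integral_divergence_mul hJ hφ1 (Or.inl hc)
  have e : ∀ x, inner ℝ (toEuclideanLin K (gradient w x)) (gradient φ x) =
      inner ℝ (toEuclideanLin K (gradient φ x)) (gradient w x) := fun x => by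
    rw [inner_toEuclideanLin_left, hK, real_inner_comm]
  simp only [e] at a1
  rw [← a2] at a1
  have l1 : ∀ x, generator J K w x * φ x =
      1 / 2 * (divergence (fun y => toEuclideanLin K (gradient w y)) x * φ x) -
        divergence (fun y => w y • toEuclideanLin J y) x * φ x := fun x => by
    rw [generator]; ring
  have l2 : ∀ x, w x * adjointGenerator J K φ x =
      1 / 2 * (divergence (fun y => toEuclideanLin K (gradient φ y)) x * w x) +
        inner ℝ (w x • toEuclideanLin J x) (gradient φ x) := fun x => by
    rw [adjointGenerator, real_inner_smul_left]; ring
  simp only [l1, l2]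
  rw [integral_sub, integral_add, integral_const_mul, integral_const_mul, a1, a3, sub_neg_eq_add]
  · exact (((continuous_divergence hKφ).mul hw.continuous).integrable_of_hasCompactSupport
      (hc.toEuclideanLin_gradient K).divergence.mul_right).const_mul _
  · refine (hJ.continuous.inner (continuous_gradient hφ1)).integrable_of_hasCompactSupport ?_
    exact hc.gradient.mono fun x hx h => hx (by simp [h])
  · exact (((continuous_divergence hKw).mul hφ.continuous).integrable_of_hasCompactSupport
      hc.mul_left).const_mul _
  · exact ((continuous_divergence hJ).mul hφ.continuous).integrable_of_hasCompactSupport hc.mul_left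

/-- Differentiation under the integral sign for integrands supported in a fixed compact set. -/
theorem hasDerivAt_integral_of_compact_support {X : Type*} [TopologicalSpace X]
    [MeasurableSpace X] [OpensMeasurableSpace X] [T2Space X] [SecondCountableTopologyEither X ℝ]
    {μ : Measure X} [IsFiniteMeasureOnCompacts μ]
    {f f' : ℝ → X → ℝ} {U : Set ℝ} (hU : IsOpen U) {k : Set X} (hk : IsCompact k)
    (hf : ContinuousOn f.uncurry (U ×ˢ univ)) (hf' : ContinuousOn f'.uncurry (U ×ˢ univ))
    (hd : ∀ s ∈ U, ∀ x, HasDerivAt (fun s => f s x) (f' s x) s)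
    (hfk : ∀ s, ∀ x ∉ k, f s x = 0) (hfk' : ∀ s, ∀ x ∉ k, f' s x = 0) {s : ℝ} (hs : s ∈ U) :
    HasDerivAt (fun s => ∫ x, f s x ∂μ) (∫ x, f' s x ∂μ) s := by
  obtain ⟨ε, hε, hball⟩ := Metric.nhds_basis_closedBall.mem_iff.1 (hU.mem_nhds hs)
  have hfc : ∀ r ∈ U, Continuous (f r) := fun r hr => by
    rw [← continuousOn_univ]
    exact hf.comp (f := fun x => (r, x)) (by fun_prop) fun x _ => ⟨hr, mem_univ _⟩
  have hfc' : ∀ r ∈ U, Continuous (f' r) := fun r hr => by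
    rw [← continuousOn_univ]
    exact hf'.comp (f := fun x => (r, x)) (by fun_prop) fun x _ => ⟨hr, mem_univ _⟩
  obtain ⟨M, hM⟩ := ((isCompact_closedBall s ε).prod hk).exists_bound_of_continuousOn
    (hf'.mono (prod_mono hball (subset_univ _)))
  refine (hasDerivAt_integral_of_dominated_loc_of_deriv_le (F := f) (F' := f')
    (bound := k.indicator fun _ => M) (Metric.closedBall_mem_nhds s hε) ?_ ?_ ?_ ?_ ?_ ?_).2
  · filter_upwards [hU.mem_nhds hs] with r hr
    exact (hfc r hr).aestronglyMeasurable
  · exact (hfc s hs).integrable_of_hasCompactSupport (HasCompactSupport.intro hk (hfk s))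
  · exact (hfc' s hs).aestronglyMeasurable
  · refine Filter.Eventually.of_forall fun x r hr => ?_
    by_cases hx : x ∈ k
    · rw [indicator_of_mem hx]
      exact hM (r, x) ⟨hr, hx⟩
    · rw [indicator_of_notMem hx, hfk' r x hx, norm_zero]
  · exact (integrable_indicator_iff hk.measurableSet).2 (integrableOn_const hk.measure_ne_top)
  · exact Filter.Eventually.of_forall fun x r hr => hd r (hball hr) x

end Weak

/-! ### Cutoff functions and their scaling -/

section Cutoff

variable {d : ℕ}

local notation "𝔼" => EuclideanSpace ℝ (Fin d)

/-- A smooth cutoff equal to `1` on the ball of radius `r` and to `0` off the ball of radius `2r`. -/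
noncomputable def cutoff (d : ℕ) (r : ℝ) (x : EuclideanSpace ℝ (Fin d)) : ℝ :=
  (⟨1, 2, one_pos, one_lt_two⟩ : ContDiffBump (0 : EuclideanSpace ℝ (Fin d))) (r⁻¹ • x)

theorem contDiff_cutoff (r : ℝ) {n : ℕ∞} : ContDiff ℝ n (cutoff d r) :=
  (ContDiffBump.contDiff _).comp (contDiff_const_smul _)

theorem cutoff_nonneg (r : ℝ) (x : 𝔼) : 0 ≤ cutoff d r x := ContDiffBump.nonneg _

theorem cutoff_le_one (r : ℝ) (x : 𝔼) : cutoff d r x ≤ 1 := ContDiffBump.le_one _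

theorem cutoff_eq_one {r : ℝ} (hr : 0 < r) {x : 𝔼} (hx : ‖x‖ ≤ r) : cutoff d r x = 1 := by
  refine ContDiffBump.one_of_mem_closedBall _ ?_
  rw [mem_closedBall_zero_iff, norm_smul, norm_inv, Real.norm_of_nonneg hr.le, inv_mul_le_iff₀ hr]
  simpa using hx

theorem cutoff_eq_zero {r : ℝ} (hr : 0 < r) {x : 𝔼} (hx : 2 * r ≤ ‖x‖) : cutoff d r x = 0 := by
  refine ContDiffBump.zero_of_le_dist _ ?_
  rw [dist_zero_right, norm_smul, norm_inv, Real.norm_of_nonneg hr.le, le_inv_mul_iff₀ hr]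
  linarith

theorem hasCompactSupport_cutoff {r : ℝ} (hr : 0 < r) : HasCompactSupport (cutoff d r) :=
  HasCompactSupport.intro (isCompact_closedBall (0 : 𝔼) (2 * r)) fun x hx =>
    cutoff_eq_zero hr (by simpa using (not_le.1 fun h => hx (mem_closedBall_zero_iff.2 h)).le)

theorem tendsto_cutoff {r : ℕ → ℝ} (hr : Filter.Tendsto r Filter.atTop Filter.atTop) (x : 𝔼) :
    Filter.Tendsto (fun n => cutoff d (r n) x) Filter.atTop (nhds 1) := by
  refine tendsto_const_nhds.congr' ?_
  filter_upwards [hr.eventually_ge_atTop (‖x‖ + 1)] with n hn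
  have := norm_nonneg x
  exact (cutoff_eq_one (by linarith) (by linarith)).symm

theorem gradient_cutoff (r : ℝ) (x : 𝔼) :
    gradient (cutoff d r) x = r⁻¹ • gradient (cutoff d 1) (r⁻¹ • x) := by
  have h : cutoff d r = fun x => cutoff d 1 (r⁻¹ • x) := by
    funext x; simp [cutoff]
  refine ext_inner_right ℝ fun v => ?_
  rw [real_inner_smul_left, inner_gradient_left, inner_gradient_left, h, fderiv_comp_smul]
  simp

theorem divergence_gradient_cutoff (K : Matrix (Fin d) (Fin d) ℝ) (r : ℝ) (x : 𝔼) :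
    divergence (fun y => toEuclideanLin K (gradient (cutoff d r) y)) x =
      r⁻¹ * (r⁻¹ * divergence (fun y => toEuclideanLin K (gradient (cutoff d 1) y)) (r⁻¹ • x)) := by
  have hd := (contDiff_toEuclideanLin_gradient K (contDiff_cutoff (d := d) 1 (n := 2))).differentiable
    (by norm_num)
  have h : (fun y => toEuclideanLin K (gradient (cutoff d r) y)) =
      r⁻¹ • fun y => (fun z => toEuclideanLin K (gradient (cutoff d 1) z)) (r⁻¹ • y) := by
    funext y
    simp only [Pi.smul_apply]
    rw [gradient_cutoff, map_smul]
  rw [h, divergence, fderiv_const_smul,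
    fderiv_comp_smul (f := fun z => toEuclideanLin K (gradient (cutoff d 1) z)), divergence,
    Finset.mul_sum,
    Finset.mul_sum]
  · simp
  · exact (hd _).comp x (differentiableAt_id.fun_const_smul _)

/-- The error terms produced by a cutoff of radius `r ≥ 1` are bounded uniformly in `r` and are
controlled by the complement of the cutoff of half the radius. -/
theorem exists_cutoff_bound (J K : Matrix (Fin d) (Fin d) ℝ) :
    ∃ C : ℝ, 0 ≤ C ∧ ∀ r : ℝ, 1 ≤ r → ∀ x : 𝔼,
      |divergence (fun y => toEuclideanLin K (gradient (cutoff d r) y)) x| +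
        ‖gradient (cutoff d r) x‖ + |inner ℝ (toEuclideanLin J x) (gradient (cutoff d r) x)| ≤
      C * (1 - cutoff d (r / 2) x) := by
  set H : 𝔼 → ℝ := fun y =>
    |divergence (fun y => toEuclideanLin K (gradient (cutoff d 1) y)) y| +
        ‖gradient (cutoff d 1) y‖ + |inner ℝ (toEuclideanLin J y) (gradient (cutoff d 1) y)| with hH
  have hcd : ContDiff ℝ 2 (cutoff d 1) := contDiff_cutoff 1
  have hKd := contDiff_toEuclideanLin_gradient K hcd
  have hg := continuous_gradient (hcd.of_le (by norm_num) : ContDiff ℝ 1 (cutoff d 1))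
  have hHc : Continuous H :=
    ((continuous_divergence hKd).abs.add hg.norm).add
      (((differentiable_toEuclideanLin J).continuous.inner hg).abs)
  have hcs := hasCompactSupport_cutoff (d := d) one_pos
  have hz : ∀ y, gradient (cutoff d 1) y = 0 →
      divergence (fun y => toEuclideanLin K (gradient (cutoff d 1) y)) y = 0 → H y = 0 :=
    fun y h1 h2 => by simp only [hH, h1, h2, inner_zero_right, norm_zero, abs_zero, add_zero]
  have hHs : HasCompactSupport H :=
    HasCompactSupport.intro (hcs.gradient.isCompact.union
      (hcs.toEuclideanLin_gradient K).divergence.isCompact) fun x hx =>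
      hz x (image_eq_zero_of_notMem_tsupport fun h => hx (Or.inl h))
        (image_eq_zero_of_notMem_tsupport fun h => hx (Or.inr h))
  have hH0 : ∀ y, ‖y‖ < 1 → H y = 0 := fun y hy => by
    have hloc : ∀ z ∈ Metric.ball (0 : 𝔼) 1, gradient (cutoff d 1) z = 0 := fun z hz => by
      have : cutoff d 1 =ᶠ[nhds z] fun _ => 1 := by
        filter_upwards [Metric.isOpen_ball.mem_nhds hz] with w hw
        exact cutoff_eq_one one_pos (mem_ball_zero_iff.1 hw).le
      refine ext_inner_right ℝ fun v => ?_
      rw [inner_gradient_left, this.fderiv_eq]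
      simp
    have hyb : y ∈ Metric.ball (0 : 𝔼) 1 := mem_ball_zero_iff.2 hy
    refine hz y (hloc y hyb) ?_
    have : (fun y => toEuclideanLin K (gradient (cutoff d 1) y)) =ᶠ[nhds y] fun _ => 0 := by
      filter_upwards [Metric.isOpen_ball.mem_nhds hyb] with w hw
      rw [hloc w hw, map_zero]
    rw [divergence, this.fderiv_eq]
    simp
  obtain ⟨C, hC⟩ := hHc.bounded_above_of_compact_support hHs
  have hC0 : 0 ≤ C := (norm_nonneg _).trans (hC 0)
  refine ⟨C, hC0, fun r hr x => ?_⟩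
  have hr0 : 0 < r := by linarith
  have hri : r⁻¹ ≤ 1 := inv_le_one_of_one_le₀ hr
  have hri0 : 0 ≤ r⁻¹ := by positivity
  -- Scaling to radius 1 costs r⁻² for the divergence and r⁻¹ for the gradient, both at most 1; the
  -- drift term is scale invariant.
  have hle : |divergence (fun y => toEuclideanLin K (gradient (cutoff d r) y)) x| +
        ‖gradient (cutoff d r) x‖ + |inner ℝ (toEuclideanLin J x) (gradient (cutoff d r) x)| ≤
      H (r⁻¹ • x) := by
    rw [divergence_gradient_cutoff, gradient_cutoff]
    simp only [hH]
    refine add_le_add (add_le_add ?_ ?_) (le_of_eq ?_)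
    · rw [abs_mul, abs_mul, abs_of_nonneg hri0, ← mul_assoc]
      exact mul_le_of_le_one_left (abs_nonneg _) (mul_le_one₀ hri hri0 hri)
    · rw [norm_smul, Real.norm_of_nonneg hri0]
      exact mul_le_of_le_one_left (norm_nonneg _) hri
    · rw [map_smul, real_inner_smul_left, real_inner_smul_right]
  refine hle.trans ?_
  by_cases hx : ‖r⁻¹ • x‖ < 1
  · rw [hH0 _ hx]
    exact mul_nonneg hC0 (sub_nonneg.2 (cutoff_le_one _ _))
  -- Here the cutoff of radius r/2 vanishes, as its support ends at 2(r/2) = r.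
  · have hx' : r ≤ ‖x‖ := by
      rw [norm_smul, Real.norm_of_nonneg hri0, not_lt, le_inv_mul_iff₀ hr0] at hx
      linarith
    rw [cutoff_eq_zero (by positivity) (by linarith), sub_zero, mul_one]
    exact (le_abs_self _).trans (hC _)

end Cutoff
end FokkerPlanck

/-! ### Plane waves for the backward adjoint equation -/

namespace FokkerPlanck
open Matrix MeasureTheory Set Filter Topology

section Uniqueness

variable {d : ℕ}

local notation "𝔼" => EuclideanSpace ℝ (Fin d)

/-- The plane wave with frequency `ξ`, phase `θ` and amplitude `exp q`. -/
noncomputable def planeWave (q : ℝ) (ξ : EuclideanSpace ℝ (Fin d)) (θ : ℝ)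
    (x : EuclideanSpace ℝ (Fin d)) : ℝ :=
  Real.exp q * Real.cos (inner ℝ ξ x + θ)

theorem contDiff_planeWave (q : ℝ) (ξ : 𝔼) (θ : ℝ) {n : WithTop ℕ∞} :
    ContDiff ℝ n (planeWave q ξ θ) :=
  contDiff_const.mul ((contDiff_const.inner ℝ contDiff_id).add contDiff_const).cos

theorem abs_planeWave_le (q : ℝ) (ξ : 𝔼) (θ : ℝ) (x : 𝔼) : |planeWave q ξ θ x| ≤ Real.exp q := by
  rw [planeWave, abs_mul, abs_of_pos (Real.exp_pos q)]
  exact mul_le_of_le_one_right (Real.exp_pos q).le (Real.abs_cos_le_one _)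

/-- Encoding -sin as a phase shift by π/2 keeps derivatives inside the same family. -/
theorem gradient_planeWave (q : ℝ) (ξ : 𝔼) (θ : ℝ) (x : 𝔼) :
    gradient (planeWave q ξ θ) x = planeWave q ξ (θ + Real.pi / 2) x • ξ := by
  have h := ((((hasFDerivAt_const ξ x).inner ℝ (hasFDerivAt_id x)).add_const θ).cos).const_mul
    (Real.exp q)
  refine ext_inner_right ℝ fun v => ?_
  rw [inner_gradient_left]
  refine (congrArg (· v) (HasFDerivAt.fderiv h)).trans ?_
  rw [planeWave, ← add_assoc, Real.cos_add_pi_div_two]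
  simp [fderivInnerCLM_apply, real_inner_smul_left, mul_assoc]

theorem gradient_mul {f g : 𝔼 → ℝ} {x : 𝔼} (hf : DifferentiableAt ℝ f x)
    (hg : DifferentiableAt ℝ g x) :
    gradient (fun y => f y * g y) x = f x • gradient g x + g x • gradient f x := by
  refine ext_inner_right ℝ fun v => ?_
  rw [inner_gradient_left, fderiv_fun_mul hf hg]
  simp [inner_add_left, real_inner_smul_left, inner_gradient_left]

/-- The error made by multiplying a plane wave solution of the adjoint equation by `χ`. -/
noncomputable def cutoffError (J K : Matrix (Fin d) (Fin d) ℝ) (q : ℝ)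
    (ξ : EuclideanSpace ℝ (Fin d)) (θ : ℝ) (χ : EuclideanSpace ℝ (Fin d) → ℝ)
    (x : EuclideanSpace ℝ (Fin d)) : ℝ :=
  1 / 2 * planeWave q ξ θ x * divergence (fun y => toEuclideanLin K (gradient χ y)) x
    + planeWave q ξ (θ + Real.pi / 2) x * inner ℝ (gradient χ x) (toEuclideanLin K ξ)
    + planeWave q ξ θ x * inner ℝ (toEuclideanLin J x) (gradient χ x)

/-- The product rule separates the terms that differentiate χ, collected in `cutoffError`, from
those that do not; the latter are what the time derivative of the wave cancels. -/
theorem adjointGenerator_planeWave_mul {J K : Matrix (Fin d) (Fin d) ℝ} (hK : Kᵀ = K) (q : ℝ)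
    (ξ : 𝔼) (θ : ℝ) {χ : 𝔼 → ℝ} (hχ : ContDiff ℝ 2 χ) (x : 𝔼) :
    adjointGenerator J K (fun y => planeWave q ξ θ y * χ y) x =
      cutoffError J K q ξ θ χ x -
        (1 / 2 * inner ℝ ξ (toEuclideanLin K ξ) * planeWave q ξ θ x -
          inner ℝ ξ (toEuclideanLin J x) * planeWave q ξ (θ + Real.pi / 2) x) * χ x := by
  have hψ : ∀ θ, Differentiable ℝ (planeWave q ξ θ) := fun θ =>
    (contDiff_planeWave q ξ θ (n := 1)).differentiable (by norm_num)
  have hχd : Differentiable ℝ χ := hχ.differentiable (by norm_num)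
  have hKd : Differentiable ℝ fun y => toEuclideanLin K (gradient χ y) :=
    (contDiff_toEuclideanLin_gradient K hχ).differentiable (by norm_num)
  have hgrad : ∀ y, gradient (fun y => planeWave q ξ θ y * χ y) y =
      planeWave q ξ θ y • gradient χ y + (planeWave q ξ (θ + Real.pi / 2) y * χ y) • ξ :=
    fun y => by
      rw [gradient_mul (hψ θ y) (hχd y), gradient_planeWave, smul_smul, mul_comm (χ y)]
  have hfun : (fun y => toEuclideanLin K (gradient (fun y => planeWave q ξ θ y * χ y) y)) =
      fun y => planeWave q ξ θ y • toEuclideanLin K (gradient χ y) +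
        (planeWave q ξ (θ + Real.pi / 2) y * χ y) • toEuclideanLin K ξ := by
    funext y
    rw [hgrad, map_add, map_smul, map_smul]
  have hconst : divergence (fun _ : 𝔼 => toEuclideanLin K ξ) x = 0 := by
    rw [divergence, fderiv_fun_const]; simp
  have hshift : planeWave q ξ (θ + Real.pi / 2 + Real.pi / 2) x = -planeWave q ξ θ x := by
    rw [planeWave, planeWave, ← add_assoc, Real.cos_add_pi_div_two, ← add_assoc,
      Real.sin_add_pi_div_two]
    ring
  have hsymm : inner ℝ ξ (toEuclideanLin K (gradient χ x)) =
      inner ℝ (gradient χ x) (toEuclideanLin K ξ) := by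
    rw [real_inner_comm, inner_toEuclideanLin_left, hK]
  rw [adjointGenerator, hfun,
    divergence_add ((hψ θ x).fun_smul (hKd x)) (((hψ _ x).fun_mul (hχd x)).smul_const _),
    divergence_smul (hψ θ x) (hKd x),
    divergence_smul (F := fun _ => toEuclideanLin K ξ) ((hψ _ x).fun_mul (hχd x))
      (differentiableAt_const _), hconst, hgrad, gradient_mul (hψ _ x) (hχd x),
    gradient_planeWave, gradient_planeWave, hshift, cutoffError]
  simp only [inner_add_left, inner_add_right, real_inner_smul_left, real_inner_smul_right, hsymm,
    real_inner_comm ξ (toEuclideanLin J x)]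
  ring

/-- Amplitude and frequency of the plane wave solution of the adjoint backward equation. -/
theorem exists_backward_wave (J K : Matrix (Fin d) (Fin d) ℝ) (b : ℝ) (ξ₀ : 𝔼) :
    ∃ (ξ : ℝ → 𝔼) (q : ℝ → ℝ), ξ b = ξ₀ ∧ q b = 0 ∧ Continuous ξ ∧
      (∀ s x, HasDerivAt (fun s => inner ℝ (ξ s) x) (-inner ℝ (ξ s) (toEuclideanLin J x)) s) ∧
      ∀ s, HasDerivAt q (1 / 2 * inner ℝ (ξ s) (toEuclideanLin K (ξ s))) s := by
  set Φ : ℝ → Matrix (Fin d) (Fin d) ℝ := fun s => NormedSpace.exp ((s - b) • (-Jᵀ)) with hΦ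
  have hΦd : ∀ s i j, HasDerivAt (fun s => Φ s i j) ((-Jᵀ * Φ s) i j) s := fun s i j =>
    (hasDerivAt_matrix_exp_smul_apply (-Jᵀ) (s - b) i j).comp_sub_const s b
  have hΦc : Continuous Φ := (continuous_matrix_exp_smul (-Jᵀ)).comp (continuous_sub_right b)
  have hξc : Continuous fun s => toEuclideanLin (Φ s) ξ₀ :=
    continuous_toEuclideanLin_apply hΦc continuous_const
  have hc : Continuous fun s => 1 / 2 * inner ℝ (toEuclideanLin (Φ s) ξ₀)
      (toEuclideanLin K (toEuclideanLin (Φ s) ξ₀)) :=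
    continuous_const.mul (hξc.inner ((differentiable_toEuclideanLin K).continuous.comp hξc))
  refine ⟨fun s => toEuclideanLin (Φ s) ξ₀, fun s => ∫ r in b..s,
    1 / 2 * inner ℝ (toEuclideanLin (Φ r) ξ₀) (toEuclideanLin K (toEuclideanLin (Φ r) ξ₀)),
    ?_, ?_, hξc, fun s x => ?_, fun s => (hc.integral_hasStrictDerivAt b s).hasDerivAt⟩
  · simp [hΦ]
  · simp
  · have hin : ∀ M : Matrix (Fin d) (Fin d) ℝ,
        inner ℝ (toEuclideanLin M ξ₀) x = ∑ i, x i * ∑ j, M i j * ξ₀ j := fun M => by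
      simp [EuclideanSpace.inner_eq_star_dotProduct, dotProduct, mulVec]
    have h : HasDerivAt (fun s => ∑ i, x i * ∑ j, Φ s i j * ξ₀ j)
        (∑ i, x i * ∑ j, (-Jᵀ * Φ s) i j * ξ₀ j) s :=
      HasDerivAt.fun_sum fun i _ => (HasDerivAt.fun_sum fun j _ =>
        (hΦd s i j).mul_const _).const_mul _
    have e : -inner ℝ (toEuclideanLin (Φ s) ξ₀) (toEuclideanLin J x) =
        inner ℝ (toEuclideanLin (-Jᵀ * Φ s) ξ₀) x := by
      rw [real_inner_comm, inner_toEuclideanLin_left, real_inner_comm, ← inner_neg_left]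
      simp [Matrix.toLpLin_apply, Matrix.mulVec_mulVec]
    simp only [hin] at e ⊢
    rw [e]
    exact h

variable {J K : Matrix (Fin d) (Fin d) ℝ} {T : EReal}
  {u : ℝ → EuclideanSpace ℝ (Fin d) → ℝ}

theorem isOpen_time_interval (T : EReal) : IsOpen {t : ℝ | 0 < t ∧ (t : EReal) < T} :=
  isOpen_Ioi.inter (isOpen_Iio.preimage continuous_coe_real_ereal)

theorem IsSolution.continuousOn_prod (hu : IsSolution J K T u) :
    ContinuousOn u.uncurry ({t : ℝ | 0 < t ∧ (t : EReal) < T} ×ˢ univ) :=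
  hu.continuousOn.mono fun _ hp => ⟨hp.1.1.le, hp.1.2⟩

/-- The equation identifies the generator with ∂ₜu, whose joint continuity is part of the definition
of a solution. -/
theorem IsSolution.continuousOn_generator (hu : IsSolution J K T u) :
    ContinuousOn (fun p : ℝ × EuclideanSpace ℝ (Fin d) => generator J K (u p.1) p.2)
      ({t : ℝ | 0 < t ∧ (t : EReal) < T} ×ˢ univ) :=
  (hu.continuousOn_deriv_time.mono fun _ hp => hp.1).congr fun p hp =>
    (hu.equation p.1 hp.1.1 hp.1.2 p.2).deriv.symm

theorem IsSolution.continuousOn_integral_mul (hu : IsSolution J K T u) {b : ℝ}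
    (hb : (b : EReal) < T) {φ : ℝ → EuclideanSpace ℝ (Fin d) → ℝ} (hφ : Continuous φ.uncurry)
    {k : Set (EuclideanSpace ℝ (Fin d))} (hk : IsCompact k) (hφk : ∀ s, ∀ x ∉ k, φ s x = 0) :
    ContinuousOn (fun s => ∫ x, u s x * φ s x) (Icc 0 b) := by
  refine continuousOn_integral_of_compact_support hk ?_ fun s x _ hx => by rw [hφk s x hx, mul_zero]
  refine ContinuousOn.mul (hu.continuousOn.mono fun p hp => ⟨hp.1.1, ?_⟩) hφ.continuousOn
  exact (EReal.coe_le_coe_iff.2 hp.1.2).trans_lt hb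

theorem hasDerivAt_planeWave {q : ℝ → ℝ} {ξ : ℝ → EuclideanSpace ℝ (Fin d)} {s q' m : ℝ}
    {x : EuclideanSpace ℝ (Fin d)} (hq : HasDerivAt q q' s)
    (hξ : HasDerivAt (fun s => inner ℝ (ξ s) x) m s) (θ : ℝ) :
    HasDerivAt (fun s => planeWave (q s) (ξ s) θ x)
      (q' * planeWave (q s) (ξ s) θ x + m * planeWave (q s) (ξ s) (θ + Real.pi / 2) x) s := by
  have h := hq.exp.mul (hξ.add_const θ).cos
  refine h.congr_deriv ?_
  rw [planeWave, planeWave, ← add_assoc, Real.cos_add_pi_div_two]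
  ring

theorem continuous_planeWave {q : ℝ → ℝ} {ξ : ℝ → EuclideanSpace ℝ (Fin d)} (hq : Continuous q)
    (hξ : Continuous ξ) (θ : ℝ) :
    Continuous fun p : ℝ × EuclideanSpace ℝ (Fin d) => planeWave (q p.1) (ξ p.1) θ p.2 := by
  unfold planeWave
  fun_prop

/-- The equation and integration by parts move the generator onto the truncated wave; since the wave
solves the backward equation, only the cutoff error survives. -/
theorem IsSolution.hasDerivAt_integral (hK : Kᵀ = K) (hu : IsSolution J K T u)
    {ξ : ℝ → EuclideanSpace ℝ (Fin d)} {q : ℝ → ℝ} (hξc : Continuous ξ)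
    (hξ : ∀ s x, HasDerivAt (fun s => inner ℝ (ξ s) x) (-inner ℝ (ξ s) (toEuclideanLin J x)) s)
    (hq : ∀ s, HasDerivAt q (1 / 2 * inner ℝ (ξ s) (toEuclideanLin K (ξ s))) s) (θ : ℝ)
    {χ : EuclideanSpace ℝ (Fin d) → ℝ} (hχ : ContDiff ℝ 2 χ) (hc : HasCompactSupport χ)
    {s : ℝ} (hs : 0 < s) (hsT : (s : EReal) < T) :
    HasDerivAt (fun s => ∫ x, u s x * (planeWave (q s) (ξ s) θ x * χ x))
      (∫ x, u s x * cutoffError J K (q s) (ξ s) θ χ x) s := by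
  have hqc : Continuous q := continuous_iff_continuousAt.2 fun s => (hq s).continuousAt
  have hχc := hχ.continuous
  have hJc := (differentiable_toEuclideanLin J).continuous
  have hKc := (differentiable_toEuclideanLin K).continuous
  set D : ℝ → EuclideanSpace ℝ (Fin d) → ℝ := fun s x =>
    1 / 2 * inner ℝ (ξ s) (toEuclideanLin K (ξ s)) * planeWave (q s) (ξ s) θ x +
      -inner ℝ (ξ s) (toEuclideanLin J x) * planeWave (q s) (ξ s) (θ + Real.pi / 2) x with hD
  have hDc : Continuous fun p : ℝ × EuclideanSpace ℝ (Fin d) => D p.1 p.2 := by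
    have h1 := continuous_planeWave hqc hξc θ
    have h2 := continuous_planeWave hqc hξc (θ + Real.pi / 2)
    have h3 : Continuous fun p : ℝ × EuclideanSpace ℝ (Fin d) => ξ p.1 := hξc.comp continuous_fst
    have h4 : Continuous fun p : ℝ × EuclideanSpace ℝ (Fin d) => toEuclideanLin J p.2 :=
      hJc.comp continuous_snd
    exact ((continuous_const.mul (h3.inner (hKc.comp h3))).mul h1).add ((h3.inner h4).neg.mul h2)
  have hψχc : Continuous fun p : ℝ × EuclideanSpace ℝ (Fin d) =>
      planeWave (q p.1) (ξ p.1) θ p.2 * χ p.2 :=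
    (continuous_planeWave hqc hξc θ).mul (hχc.comp continuous_snd)
  have hmain := hasDerivAt_integral_of_compact_support (μ := volume)
    (f := fun s x => u s x * (planeWave (q s) (ξ s) θ x * χ x))
    (f' := fun s x => generator J K (u s) x * (planeWave (q s) (ξ s) θ x * χ x) +
      u s x * (D s x * χ x)) (isOpen_time_interval T) hc.isCompact
    (hu.continuousOn_prod.mul hψχc.continuousOn)
    ((hu.continuousOn_generator.mul hψχc.continuousOn).add
      (hu.continuousOn_prod.mul (hDc.mul (hχc.comp continuous_snd)).continuousOn))
    (fun r hr x => (hu.equation r hr.1 hr.2 x).mul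
      ((hasDerivAt_planeWave (hq r) (hξ r x) θ).mul_const (χ x)))
    (fun r x hx => by simp [image_eq_zero_of_notMem_tsupport hx])
    (fun r x hx => by simp [image_eq_zero_of_notMem_tsupport hx]) ⟨hs, hsT⟩
  refine hmain.congr_deriv ?_
  have hw := hu.contDiff_space s hs hsT
  have hφ : ContDiff ℝ 2 fun x => planeWave (q s) (ξ s) θ x * χ x :=
    (contDiff_planeWave _ _ _).mul hχ
  have hφc : HasCompactSupport fun x => planeWave (q s) (ξ s) θ x * χ x := hc.mul_left
  have hgen : Continuous (generator J K (u s)) := by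
    rw [← continuousOn_univ]
    exact hu.continuousOn_generator.comp (f := fun x => (s, x)) (by fun_prop)
      fun x _ => ⟨⟨hs, hsT⟩, mem_univ _⟩
  have hDs : Continuous (D s) := hDc.comp (f := fun x => (s, x)) (by fun_prop)
  have hadj : Continuous (adjointGenerator J K fun x => planeWave (q s) (ξ s) θ x * χ x) :=
    (continuous_const.mul (continuous_divergence (contDiff_toEuclideanLin_gradient K hφ))).add
      (hJc.inner (continuous_gradient (hφ.of_le (by norm_num))))
  have i2 : Integrable fun x => u s x * (D s x * χ x) :=
    (hw.continuous.mul (hDs.mul hχc)).integrable_of_hasCompactSupport hc.mul_left.mul_left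
  have hadjc : HasCompactSupport
      (adjointGenerator J K fun x => planeWave (q s) (ξ s) θ x * χ x) := by
    refine HasCompactSupport.intro (hφc.gradient.isCompact.union
      (hφc.toEuclideanLin_gradient K).divergence.isCompact) fun x hx => ?_
    rw [adjointGenerator, image_eq_zero_of_notMem_tsupport fun h => hx (Or.inl h),
      image_eq_zero_of_notMem_tsupport fun h => hx (Or.inr h), inner_zero_right, mul_zero, add_zero]
  have i1 : Integrable fun x => generator J K (u s) x * (planeWave (q s) (ξ s) θ x * χ x) :=
    (hgen.mul hφ.continuous).integrable_of_hasCompactSupport hφc.mul_left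
  have i3 : Integrable fun x =>
      u s x * adjointGenerator J K (fun x => planeWave (q s) (ξ s) θ x * χ x) x :=
    (hw.continuous.mul hadj).integrable_of_hasCompactSupport hadjc.mul_left
  rw [integral_add i1 i2, integral_generator_mul hK hw hφ hφc, ← integral_add i3 i2]
  refine integral_congr_ae (Eventually.of_forall fun x => ?_)
  simp only [adjointGenerator_planeWave_mul hK _ _ _ hχ, hD]
  ring

end Uniqueness
end FokkerPlanck

/-! ### Removing the cutoff, and uniqueness -/

namespace FokkerPlanck
open Matrix MeasureTheory Set Filter Topology

section Uniqueness

variable {d : ℕ} {J K : Matrix (Fin d) (Fin d) ℝ} {T : EReal}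
  {u : ℝ → EuclideanSpace ℝ (Fin d) → ℝ}

local notation "𝔼" => EuclideanSpace ℝ (Fin d)

theorem IsPDF.integrable_mul {w : 𝔼 → ℝ} (hw : IsPDF w) {g : 𝔼 → ℝ} (hg : Continuous g) {C : ℝ}
    (hC : ∀ x, |g x| ≤ C) : Integrable fun x => w x * g x :=
  hw.integrable.mul_bdd hg.aestronglyMeasurable (Eventually.of_forall hC)

theorem IsPDF.tendsto_integral_mul_cutoff {w : 𝔼 → ℝ} (hw : IsPDF w) {g : 𝔼 → ℝ}
    (hg : Continuous g) {C : ℝ} (hC : ∀ x, |g x| ≤ C) {r : ℕ → ℝ} (hr : Tendsto r atTop atTop) :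
    Tendsto (fun n => ∫ x, w x * (g x * cutoff d (r n) x)) atTop (𝓝 (∫ x, w x * g x)) := by
  refine tendsto_integral_of_dominated_convergence (fun x => ‖w x * g x‖) (fun n => ?_)
    (hw.integrable_mul hg hC).norm (fun n => Eventually.of_forall fun x => ?_)
    (Eventually.of_forall fun x => ?_)
  · exact hw.integrable.aestronglyMeasurable.mul
      (hg.mul (contDiff_cutoff (r n) (n := 0)).continuous).aestronglyMeasurable
  · rw [← mul_assoc, norm_mul _ (cutoff d (r n) x), Real.norm_of_nonneg (cutoff_nonneg _ _)]
    exact mul_le_of_le_one_right (norm_nonneg _) (cutoff_le_one _ _)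
  · simpa using ((tendsto_cutoff hr x).const_mul (g x)).const_mul (w x)

/-- Separates a factor depending only on the wave, bounded on compact time intervals, from the
cutoff quantity bounded in `exists_cutoff_bound`. -/
theorem abs_cutoffError_le (J K : Matrix (Fin d) (Fin d) ℝ) (q : ℝ) (ξ : 𝔼) (θ : ℝ) (χ : 𝔼 → ℝ)
    (x : 𝔼) : |cutoffError J K q ξ θ χ x| ≤ Real.exp q * (1 + ‖toEuclideanLin K ξ‖) *
      (|divergence (fun y => toEuclideanLin K (gradient χ y)) x| + ‖gradient χ x‖ +
        |inner ℝ (toEuclideanLin J x) (gradient χ x)|) := by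
  set A := divergence (fun y => toEuclideanLin K (gradient χ y)) x
  set B := inner ℝ (toEuclideanLin J x) (gradient χ x)
  set k := ‖toEuclideanLin K ξ‖
  have hk : 0 ≤ k := norm_nonneg _
  have hq := Real.exp_pos q
  have h1 := abs_planeWave_le q ξ θ x
  have h2 := abs_planeWave_le q ξ (θ + Real.pi / 2) x
  have h3 := abs_real_inner_le_norm (gradient χ x) (toEuclideanLin K ξ)
  have hg := norm_nonneg (gradient χ x)
  have e1 : |1 / 2 * planeWave q ξ θ x * A| ≤ Real.exp q * |A| := by
    rw [abs_mul, abs_mul]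
    refine mul_le_mul_of_nonneg_right ?_ (abs_nonneg _)
    rw [abs_of_pos (by norm_num : (0 : ℝ) < 1 / 2)]
    linarith [abs_nonneg (planeWave q ξ θ x)]
  have e2 : |planeWave q ξ (θ + Real.pi / 2) x * inner ℝ (gradient χ x) (toEuclideanLin K ξ)| ≤
      Real.exp q * (‖gradient χ x‖ * k) := by
    rw [abs_mul]
    exact mul_le_mul h2 h3 (abs_nonneg _) hq.le
  have e3 : |planeWave q ξ θ x * B| ≤ Real.exp q * |B| := by
    rw [abs_mul]
    exact mul_le_mul_of_nonneg_right h1 (abs_nonneg _)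
  have hsum : |cutoffError J K q ξ θ χ x| ≤
      Real.exp q * |A| + Real.exp q * (‖gradient χ x‖ * k) + Real.exp q * |B| :=
    (abs_add_three _ _ _).trans (add_le_add (add_le_add e1 e2) e3)
  refine hsum.trans ?_
  have p1 : 0 ≤ Real.exp q * (k * |A|) := by positivity
  have p2 : 0 ≤ Real.exp q * (k * |B|) := by positivity
  have p3 : 0 ≤ Real.exp q * ‖gradient χ x‖ := by positivity
  linarith

/-- Differentiability is needed only in the open interval, which suits an equation that holds for t
> 0 with mere continuity at t = 0. -/
theorem abs_sub_le_integral_of_abs_deriv_le {f f' g : ℝ → ℝ} {a b : ℝ} (hab : a ≤ b)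
    (hf : ContinuousOn f (Icc a b)) (hf' : ∀ s ∈ Ioo a b, HasDerivAt f (f' s) s)
    (hg : ContinuousOn g (Icc a b)) (hle : ∀ s ∈ Ioo a b, |f' s| ≤ g s) :
    |f b - f a| ≤ ∫ s in a..b, g s := by
  have hgi : IntegrableOn g (Icc a b) := hg.integrableOn_Icc
  rw [abs_le']
  constructor
  · exact intervalIntegral.sub_le_integral_of_hasDeriv_right_of_le hab hf
      (fun s hs => (hf' s hs).hasDerivWithinAt) hgi fun s hs => (le_abs_self _).trans (hle s hs)
  · have := intervalIntegral.sub_le_integral_of_hasDeriv_right_of_le hab hf.neg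
      (fun s hs => (hf' s hs).neg.hasDerivWithinAt) hgi
      fun s hs => (neg_le_abs _).trans (hle s hs)
    simp only [Pi.neg_apply] at this
    linarith

/-- Plane waves solving the adjoint backward equation have conserved integral against `u`. -/
theorem IsSolution.integral_planeWave_eq (hK : Kᵀ = K) (hu : IsSolution J K T u)
    {ξ : ℝ → EuclideanSpace ℝ (Fin d)} {q : ℝ → ℝ} (hξc : Continuous ξ)
    (hξ : ∀ s x, HasDerivAt (fun s => inner ℝ (ξ s) x) (-inner ℝ (ξ s) (toEuclideanLin J x)) s)
    (hq : ∀ s, HasDerivAt q (1 / 2 * inner ℝ (ξ s) (toEuclideanLin K (ξ s))) s) (θ : ℝ)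
    {b : ℝ} (hb : 0 < b) (hbT : (b : EReal) < T) :
    ∫ x, u b x * planeWave (q b) (ξ b) θ x = ∫ x, u 0 x * planeWave (q 0) (ξ 0) θ x := by
  have hqc : Continuous q := continuous_iff_continuousAt.2 fun s => (hq s).continuousAt
  have hKc := (differentiable_toEuclideanLin K).continuous
  have hT : ∀ s ∈ Icc 0 b, (s : EReal) < T := fun s hs =>
    (EReal.coe_le_coe_iff.2 hs.2).trans_lt hbT
  have hpdf : ∀ s ∈ Icc 0 b, IsPDF (u s) := fun s hs => hu.isPDF s hs.1 (hT s hs)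
  obtain ⟨M, hM⟩ := (isCompact_Icc (a := (0 : ℝ)) (b := b)).exists_bound_of_continuousOn
    (f := fun s => Real.exp (q s) * (1 + ‖toEuclideanLin K (ξ s)‖))
    ((Real.continuous_exp.comp hqc).mul (continuous_const.add (hKc.comp hξc).norm)).continuousOn
  obtain ⟨C, hC0, hC⟩ := exists_cutoff_bound J K
  set r : ℕ → ℝ := fun n => n + 1 with hr
  have hr1 : ∀ n, 1 ≤ r n := fun n => by simp [hr]
  have hr0 : ∀ n, 0 < r n := fun n => one_pos.trans_le (hr1 n)
  have hrt : Tendsto r atTop atTop := tendsto_atTop_add_const_right _ _ tendsto_natCast_atTop_atTop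
  have hrt2 : Tendsto (fun n => r n / 2) atTop atTop := hrt.atTop_div_const two_pos
  set F : ℕ → ℝ → ℝ := fun n s => ∫ x, u s x * (planeWave (q s) (ξ s) θ x * cutoff d (r n) x)
  -- The mass of u(s) missed by the half-radius cutoff. Written as 1 minus an integral with compact
  -- support, it is visibly continuous in s.
  set m : ℕ → ℝ → ℝ := fun n s => 1 - ∫ x, u s x * cutoff d (r n / 2) x with hm
  have hcutc : ∀ r, Continuous (cutoff d r) := fun r => (contDiff_cutoff r (n := 0)).continuous
  have hcutb : ∀ (r : ℝ) (x : 𝔼), |cutoff d r x| ≤ 1 := fun r x => by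
    rw [abs_of_nonneg (cutoff_nonneg _ _)]; exact cutoff_le_one _ _
  have hFc : ∀ n, ContinuousOn (F n) (Icc 0 b) := fun n =>
    hu.continuousOn_integral_mul hbT (φ := fun s x => planeWave (q s) (ξ s) θ x * cutoff d (r n) x)
      ((continuous_planeWave hqc hξc θ).mul ((hcutc _).comp continuous_snd))
      (hasCompactSupport_cutoff (hr0 n)).isCompact
      fun s x hx => by rw [image_eq_zero_of_notMem_tsupport hx, mul_zero]
  have hmc : ∀ n, ContinuousOn (m n) (Icc 0 b) := fun n =>
    continuousOn_const.sub (hu.continuousOn_integral_mul hbT (φ := fun _ => cutoff d (r n / 2))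
      ((hcutc _).comp continuous_snd)
      (hasCompactSupport_cutoff (half_pos (hr0 n))).isCompact
      fun s x hx => image_eq_zero_of_notMem_tsupport hx)
  have hm_eq : ∀ n, ∀ s ∈ Icc 0 b, m n s = ∫ x, u s x * (1 - cutoff d (r n / 2) x) :=
    fun n s hs => by
      have h := hpdf s hs
      simp only [hm, mul_sub, mul_one]
      rw [integral_sub h.integrable (h.integrable_mul (hcutc _) (hcutb _)), h.integral_eq_one]
  have hm0 : ∀ n, ∀ s ∈ Icc 0 b, 0 ≤ m n s := fun n s hs => by
    rw [hm_eq n s hs]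
    exact integral_nonneg fun x =>
      mul_nonneg ((hpdf s hs).nonneg x) (sub_nonneg.2 (cutoff_le_one _ _))
  have hm1 : ∀ n, ∀ s ∈ Icc 0 b, m n s ≤ 1 := fun n s hs => by
    have : 0 ≤ ∫ x, u s x * cutoff d (r n / 2) x := integral_nonneg fun x =>
      mul_nonneg ((hpdf s hs).nonneg x) (cutoff_nonneg _ _)
    simp only [hm]
    linarith
  have hmt : ∀ s ∈ Icc 0 b, Tendsto (fun n => m n s) atTop (𝓝 0) := fun s hs => by
    have h := (hpdf s hs).tendsto_integral_mul_cutoff (g := fun _ => 1) continuous_const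
      (C := 1) (by simp) hrt2
    simp only [one_mul, mul_one, (hpdf s hs).integral_eq_one] at h
    simpa [hm] using h.const_sub 1
  have hder : ∀ n, ∀ s ∈ Ioo 0 b, HasDerivAt (F n)
      (∫ x, u s x * cutoffError J K (q s) (ξ s) θ (cutoff d (r n)) x) s := fun n s hs =>
    hu.hasDerivAt_integral hK hξc hξ hq θ (contDiff_cutoff _ (n := 2))
      (hasCompactSupport_cutoff (hr0 n)) hs.1 (hT s (Ioo_subset_Icc_self hs))
  have hbound : ∀ n, ∀ s ∈ Ioo 0 b,
      |∫ x, u s x * cutoffError J K (q s) (ξ s) θ (cutoff d (r n)) x| ≤ M * C * m n s :=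
    fun n s hs => by
      have hs' := Ioo_subset_Icc_self hs
      have h := hpdf s hs'
      rw [hm_eq n s hs', ← integral_const_mul]
      refine (Real.norm_eq_abs _).symm.le.trans (norm_integral_le_of_norm_le
        ((h.integrable_mul (continuous_const.sub (hcutc _)) (C := 1) fun x => ?_).const_mul _)
        (Eventually.of_forall fun x => ?_))
      · change |1 - cutoff d (r n / 2) x| ≤ 1
        rw [abs_of_nonneg (sub_nonneg.2 (cutoff_le_one _ _))]
        linarith [cutoff_nonneg (r n / 2) x]
      · have hMs : Real.exp (q s) * (1 + ‖toEuclideanLin K (ξ s)‖) ≤ M :=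
          (le_abs_self _).trans (hM s hs')
        have hp : 0 ≤ Real.exp (q s) * (1 + ‖toEuclideanLin K (ξ s)‖) := by positivity
        rw [norm_mul, Real.norm_of_nonneg (h.nonneg x), Real.norm_eq_abs, ← mul_assoc,
          mul_comm _ (u s x), mul_assoc]
        refine mul_le_mul_of_nonneg_left ?_ (h.nonneg x)
        refine (abs_cutoffError_le J K (q s) (ξ s) θ (cutoff d (r n)) x).trans ?_
        rw [mul_assoc M]
        exact mul_le_mul hMs (hC (r n) (hr1 n) x) (by positivity) (hp.trans hMs)
  have hdiff : ∀ n, |F n b - F n 0| ≤ ∫ s in (0 : ℝ)..b, M * C * m n s := fun n =>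
    abs_sub_le_integral_of_abs_deriv_le hb.le (hFc n) (hder n)
      (continuousOn_const.mul (hmc n)) (hbound n)
  -- Pointwise decay in s and the bound m ≤ 1 suffice; no tightness uniform in time is required.
  have hlim : Tendsto (fun n => ∫ s in (0 : ℝ)..b, M * C * m n s) atTop (𝓝 0) := by
    have hsub : uIoc 0 b ⊆ Icc 0 b := by
      rw [uIoc_of_le hb.le]; exact Ioc_subset_Icc_self
    have := intervalIntegral.tendsto_integral_filter_of_dominated_convergence
      (μ := volume) (a := 0) (b := b) (l := atTop) (F := fun n s => M * C * m n s)
      (f := fun _ => (0 : ℝ)) (fun _ => |M * C|) (Eventually.of_forall fun n => ?_)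
      (Eventually.of_forall fun n => Eventually.of_forall fun s hs => ?_)
      intervalIntegrable_const (Eventually.of_forall fun s hs => ?_)
    · simpa using this
    · exact ((continuousOn_const.mul (hmc n)).mono hsub).aestronglyMeasurable measurableSet_uIoc
    · rw [norm_mul, Real.norm_of_nonneg (hm0 n s (hsub hs)), Real.norm_eq_abs]
      exact mul_le_of_le_one_right (abs_nonneg _) (hm1 n s (hsub hs))
    · simpa using (hmt s (hsub hs)).const_mul (M * C)
  have hFt : ∀ s ∈ Icc 0 b, Tendsto (fun n => F n s) atTop
      (𝓝 (∫ x, u s x * planeWave (q s) (ξ s) θ x)) := fun s hs =>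
    (hpdf s hs).tendsto_integral_mul_cutoff (contDiff_planeWave _ _ _ (n := 0)).continuous
      (abs_planeWave_le _ _ _) hrt
  have hsub := (hFt b ⟨hb.le, le_rfl⟩).sub (hFt 0 ⟨le_rfl, hb.le⟩)
  exact sub_eq_zero.1 (tendsto_nhds_unique hsub (squeeze_zero_norm hdiff hlim))

/-- Phases 0 and -π/2 give the real and imaginary parts of the characteristic function, which
determines the measure; its density is then determined almost everywhere, and everywhere by
continuity. -/
theorem IsPDF.eq_of_integral_cos_eq {v w : 𝔼 → ℝ} (hv : IsPDF v) (hw : IsPDF w)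
    (hvc : Continuous v) (hwc : Continuous w)
    (h : ∀ (ξ : 𝔼) (θ : ℝ), ∫ x, v x * Real.cos (inner ℝ ξ x + θ) =
      ∫ x, w x * Real.cos (inner ℝ ξ x + θ)) : v = w := by
  have hfin : ∀ {w : 𝔼 → ℝ}, IsPDF w →
      IsFiniteMeasure (volume.withDensity fun x => ENNReal.ofReal (w x)) := fun hw =>
    isFiniteMeasure_withDensity_ofReal hw.integrable.2
  have hchar : ∀ {w : 𝔼 → ℝ}, IsPDF w → Continuous w → ∀ ξ : 𝔼,
      charFun (volume.withDensity fun x => ENNReal.ofReal (w x)) ξ =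
        ((∫ x, w x * Real.cos (inner ℝ ξ x + 0) : ℝ) : ℂ) +
          ((∫ x, w x * Real.cos (inner ℝ ξ x + -(Real.pi / 2)) : ℝ) : ℂ) * Complex.I := by
    intro w hw hwc ξ
    have hint : ∀ θ : ℝ, Integrable fun x => w x * Real.cos (inner ℝ ξ x + θ) := fun θ =>
      hw.integrable_mul (by fun_prop) (C := 1) fun x => Real.abs_cos_le_one _
    have hintc : ∀ θ : ℝ, Integrable fun x => ((w x * Real.cos (inner ℝ ξ x + θ) : ℝ) : ℂ) :=
      fun θ => (hint θ).ofReal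
    rw [charFun_apply, integral_withDensity_eq_integral_toReal_smul
      hwc.measurable.ennreal_ofReal (by simp), ← integral_complex_ofReal,
      ← integral_complex_ofReal, ← integral_mul_const, ← integral_add (hintc 0)
        ((hintc _).mul_const _)]
    refine integral_congr_ae (Eventually.of_forall fun x => ?_)
    simp only [ENNReal.toReal_ofReal (hw.nonneg x), add_zero, ← sub_eq_add_neg,
      Real.cos_sub_pi_div_two, Complex.real_smul, Complex.exp_mul_I, real_inner_comm x ξ,
      Complex.ofReal_mul, Complex.ofReal_cos, Complex.ofReal_sin]
    ring
  have := hfin hv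
  have := hfin hw
  have hμ := Measure.ext_of_charFun (μ := volume.withDensity fun x => ENNReal.ofReal (v x))
    (ν := volume.withDensity fun x => ENNReal.ofReal (w x)) (by
      funext ξ
      rw [hchar hv hvc, hchar hw hwc, h, h])
  have hae := (withDensity_eq_iff_of_sigmaFinite hvc.measurable.ennreal_ofReal.aemeasurable
    hwc.measurable.ennreal_ofReal.aemeasurable).1 hμ
  refine Continuous.ae_eq_iff_eq volume hvc hwc |>.1 ?_
  filter_upwards [hae] with x hx
  exact (ENNReal.ofReal_eq_ofReal_iff (hv.nonneg x) (hw.nonneg x)).1 hx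

/-- Solutions of the Fokker-Planck equation are determined by their initial values. -/
theorem IsSolution.unique (hK : Kᵀ = K) {T' : EReal} {v : ℝ → 𝔼 → ℝ} (hu : IsSolution J K T u)
    (hv : IsSolution J K T' v) (h0 : u 0 = v 0) {t : ℝ} (ht : 0 < t) (htT : (t : EReal) < T)
    (htT' : (t : EReal) < T') : u t = v t := by
  refine (hu.isPDF t ht.le htT).eq_of_integral_cos_eq (hv.isPDF t ht.le htT')
    (hu.contDiff_space t ht htT).continuous (hv.contDiff_space t ht htT').continuous fun ξ₀ θ => ?_
  -- At time t this wave is exactly cos(ξ₀·x + θ), while at time 0 it is tested against the common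
  -- initial density.
  obtain ⟨ξ, q, hξ₀, hq₀, hξc, hξ, hq⟩ := exists_backward_wave J K t ξ₀
  have h1 := hu.integral_planeWave_eq hK hξc hξ hq θ ht htT
  have h2 := hv.integral_planeWave_eq hK hξc hξ hq θ ht htT'
  rw [h0, ← h2] at h1
  simpa [planeWave, hξ₀, hq₀] using h1

end Uniqueness
end FokkerPlanck

theorem claim1 (d : ℕ) (J K S₀ : Matrix (Fin d) (Fin d) ℝ)
    (hK : K.PosSemidef) (hS₀ : S₀.PosDef) :
    ∃ S : ℝ → Matrix (Fin d) (Fin d) ℝ,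
      S 0 = S₀ ∧
      (∀ t : ℝ, 0 ≤ t → (S t).PosDef) ∧
      FokkerPlanck.IsSolution J K ⊤ (fun t => FokkerPlanck.gaussianDensity (S t)) ∧
      ∀ (T : EReal) (u : ℝ → EuclideanSpace ℝ (Fin d) → ℝ),
        FokkerPlanck.IsSolution J K T u →
        u 0 = FokkerPlanck.gaussianDensity S₀ →
        ∀ t : ℝ, 0 < t → (t : EReal) < T →
          u t = FokkerPlanck.gaussianDensity (S t) := by
  have hpos : ∀ t : ℝ, 0 ≤ t → (FokkerPlanck.lyapunovFlow J K S₀ t).PosDef := fun t ht =>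
    FokkerPlanck.lyapunovFlow_posDef J K S₀ hK hS₀ ht
  have hsol := FokkerPlanck.isSolution_gaussianDensity hpos
    (FokkerPlanck.hasDerivAt_lyapunovFlow J K S₀)
  refine ⟨_, FokkerPlanck.lyapunovFlow_zero J K S₀, hpos, hsol, fun T u hu h0 t ht htT => ?_⟩
  refine hu.unique (by simpa using hK.isHermitian.eq) hsol ?_ ht htT (EReal.coe_lt_top t)
  rw [h0, FokkerPlanck.lyapunovFlow_zero]
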